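/- Let $1<p<\infty$ and let $X=(X,d,\mu)$ be an unbounded metric space equipped with a positive complete Borel measure $\mu$ (defined on the completion of the Borel $\sigma$-algebra) such that $0<\mu(B)<\infty$ for all balls $B\subset X$. Fix $x_0\in X$ and $r_0>0$, and write $B(x,r)=\{y\in X:d(x,y)<r\}$ and $B_r=B(x_0,r)$. **Definitions.** For $1\le q<\infty$, a property holds for $q$-almost every curve if there is a nonnegative $\rho\in L^q_{\rm loc}(X)$ such that $\int_\gamma\rho\,ds=\infty$ for every curve $\gamma$ for which it fails; here $\rho\in L^q_{\rm loc}(X)$ means that every point of $X$ is the centre of a ball on which $\rho$ is $L^q$. A measurable $g:X\to[0,\infty]$ is a $q$-weak upper gradient of $u:X\to[-\infty,\infty]$ if $|u(\gamma(0))-u(\gamma(l_\gamma))|\le\int_\gamma g\,ds$ for $q$-almost every nonconstant compact rectifiable curve $\gamma:[0,l_\gamma]\to X$ parameterized by arc length, where the left-hand side is $\infty$ if one of its terms is infinite. The Newtonian space $N^{1,p}(X)$ consists of all (everywhere defined) measurable $u:X\to[-\infty,\infty]$ with $\int_X|u|^p\,d\mu+\inf_g\int_X g^p\,d\mu<\infty$,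 the infimum being over all $p$-weak upper gradients $g$ of $u$; $g_u$ denotes the minimal $p$-weak upper gradient of $u$. For $E\subset X$ let $$\operatorname{cap}_p(E,X)=\inf\Big\{\int_X g_u^p\,d\mu: u\in N^{1,p}(X),\ u\ge1\text{ on }E\Big\}.$$ The unbounded space $X$ is $p$-parabolic if $\operatorname{cap}_p(B,X)=0$ for all balls $B\subset X$. We say that, for large radii at $x_0$, $\mu$ * is doubling, if there are $R_0,C>0$ with $\mu(B_{2r})\le C\mu(B_r)$ for all $r\ge R_0$; * is reverse-doubling, if there are $R_0>0$ and $\xi,C>1$ with $\mu(B_{\xi r})\ge C\mu(B_r)$ for all $r\ge R_0$; * supports a $p_0$-Poincaré inequality, if there are $R_0,C>0$ and $\lambda\ge1$ such that for all $r\ge R_0$, all integrable functions $u$ on $X$ and all $p_0$-weak upper gradients $g$ of $u$, $$\frac1{\mu(B_r)}\int_{B_r}|u-u_{B_r}|\,d\mu\le Cr\Big(\frac1{\mu(B_{\lambda r})}\int_{B_{\lambda r}}g^{p_0}\,d\mu\Big)^{1/p_0},\qquad u_{B_r}=\frac1{\mu(B_r)}\int_{B_r}u\,d\mu.$$ **Theorem.**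 The space $X$ is $p$-parabolic if $$\int_{r_0}^\infty\Big(\frac{\rho}{\mu(B_\rho)}\Big)^{1/(p-1)}\,d\rho=\infty.\qquad(*)$$ If moreover, for large radii, $\mu$ is doubling and reverse-doubling at $x_0$ and supports a $p_0$-Poincaré inequality at $x_0$ for some $1\le p_0<p$, then $X$ is $p$-parabolic if and only if $(*)$ holds. -/

import Mathlib

open MeasureTheory Set
open scoped ENNReal

/-! Newtonian (Sobolev) spaces, variational capacity and `p`-parabolicity on a metric measure
space `(X, d, μ)`.

The space carries its Borel `σ`-algebra. Measurability with respect to the completion of the Borel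
`σ`-algebra under `μ` is expressed by `AEMeasurable _ μ`. -/

namespace MetricSobolev

/-- A nonconstant compact rectifiable curve in `X`, parameterized by arc length: a map
`γ : [0, l] → X`, `0 < l < ∞`, whose restriction to `[s, t]` has length `t - s` whenever
`0 ≤ s ≤ t ≤ l`. (Such a map is `1`-Lipschitz, so continuity is automatic; the values of `toFun`
outside `[0, l]` play no role.) -/
structure ArcCurve (X : Type*) [PseudoEMetricSpace X] where
  /-- the length of the curve -/
  length : ℝ
  /-- the arc length parameterization -/
  toFun : ℝ → X
  length_pos : 0 < length
  unitSpeed : HasUnitSpeedOn toFun (Icc 0 length)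

/-- The starting point of a curve. -/
def ArcCurve.source {X : Type*} [PseudoEMetricSpace X] (γ : ArcCurve X) : X := γ.toFun 0

/-- The end point of a curve. -/
def ArcCurve.target {X : Type*} [PseudoEMetricSpace X] (γ : ArcCurve X) : X := γ.toFun γ.length

/-- The curve integral `∫_γ g ds`. -/
noncomputable def arcIntegral {X : Type*} [PseudoEMetricSpace X] (γ : ArcCurve X)
    (g : X → ℝ≥0∞) : ℝ≥0∞ :=
  ∫⁻ t in Icc 0 γ.length, g (γ.toFun t)

/-- A nonnegative measurable function belongs to `L^p_loc(X)`: every point is the centre of a ball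
of positive radius on which the function is `p`-integrable. -/
def IsLpLoc {X : Type*} [MetricSpace X] [MeasurableSpace X] (p : ℝ) (μ : Measure X)
    (g : X → ℝ≥0∞) : Prop :=
  AEMeasurable g μ ∧ ∀ x : X, ∃ r : ℝ, 0 < r ∧ ∫⁻ y in Metric.ball x r, g y ^ p ∂μ < ∞

/-- `P` holds for `p`-almost every curve: the family of curves for which it fails has zero
`p`-modulus, i.e. there is a nonnegative `ρ ∈ L^p_loc(X)` with `∫_γ ρ ds = ∞` for all curves `γ`
of that family. -/
def AECurve {X : Type*} [MetricSpace X] [MeasurableSpace X] (p : ℝ) (μ : Measure X)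
    (P : ArcCurve X → Prop) : Prop :=
  ∃ ρ : X → ℝ≥0∞, IsLpLoc p μ ρ ∧ ∀ γ : ArcCurve X, ¬ P γ → arcIntegral γ ρ = ∞

open Classical in
/-- `|a - b|` for extended real numbers, with the convention that it is `∞` as soon as one of
`a`, `b` is infinite. -/
noncomputable def gap (a b : EReal) : ℝ≥0∞ :=
  if a = ⊤ ∨ a = ⊥ ∨ b = ⊤ ∨ b = ⊥ then ∞ else ENNReal.ofReal |a.toReal - b.toReal|

/-- `g : X → [0, ∞]` is a `p`-weak upper gradient of `u : X → [-∞, ∞]`. -/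
def IsWeakUpperGradient {X : Type*} [MetricSpace X] [MeasurableSpace X] (p : ℝ) (μ : Measure X)
    (u : X → EReal) (g : X → ℝ≥0∞) : Prop :=
  AEMeasurable g μ ∧
    AECurve p μ fun γ => gap (u γ.source) (u γ.target) ≤ arcIntegral γ g

/-- `g ∈ L^p_loc(X)` is a minimal `p`-weak upper gradient of `u`. -/
def IsMinimalWeakUpperGradient {X : Type*} [MetricSpace X] [MeasurableSpace X] (p : ℝ)
    (μ : Measure X) (u : X → EReal) (g : X → ℝ≥0∞) : Prop :=
  IsWeakUpperGradient p μ u g ∧ IsLpLoc p μ g ∧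
    ∀ g' : X → ℝ≥0∞, IsWeakUpperGradient p μ u g' → IsLpLoc p μ g' → g ≤ᵐ[μ] g'

/-- `u` belongs to the Newtonian space `N^{1,p}(X)`: it is a measurable, everywhere defined
extended real valued function with
`‖u‖^p = ∫ |u|^p dμ + inf_g ∫ g^p dμ < ∞`, the infimum over all `p`-weak upper gradients of `u`. -/
def MemNewtonian {X : Type*} [MetricSpace X] [MeasurableSpace X] (p : ℝ) (μ : Measure X)
    (u : X → EReal) : Prop :=
  AEMeasurable u μ ∧
    (∫⁻ x, (u x).abs ^ p ∂μ) +
      (⨅ (g : X → ℝ≥0∞) (_ : IsWeakUpperGradient p μ u g), ∫⁻ x, g x ^ p ∂μ) < ∞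

/-- The `p`-energy `∫_Ω g_u^p dμ`, written as the infimum of `∫_Ω g^p dμ` over the `p`-weak upper
gradients `g ∈ L^p_loc(X)` of `u`. It is attained by the minimal `p`-weak upper gradient `g_u`, see
`energy_eq_of_isMinimal`. -/
noncomputable def energy {X : Type*} [MetricSpace X] [MeasurableSpace X] (p : ℝ) (μ : Measure X)
    (u : X → EReal) (Ω : Set X) : ℝ≥0∞ :=
  ⨅ (g : X → ℝ≥0∞) (_ : IsWeakUpperGradient p μ u g) (_ : IsLpLoc p μ g), ∫⁻ x in Ω, g x ^ p ∂μ

theorem energy_eq_of_isMinimal {X : Type*} [MetricSpace X] [MeasurableSpace X] {p : ℝ}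
    (hp : 0 ≤ p) {μ : Measure X} {u : X → EReal} {g : X → ℝ≥0∞}
    (hg : IsMinimalWeakUpperGradient p μ u g) (Ω : Set X) :
    energy p μ u Ω = ∫⁻ x in Ω, g x ^ p ∂μ := by
  apply le_antisymm
  · exact iInf_le_of_le g (iInf_le_of_le hg.1 (iInf_le_of_le hg.2.1 le_rfl))
  · refine le_iInf fun g' => le_iInf fun h1 => le_iInf fun h2 => ?_
    refine lintegral_mono_ae ?_
    filter_upwards [ae_restrict_of_ae (hg.2.2 g' h1 h2)] with x hx
    exact ENNReal.rpow_le_rpow hx hp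

/-- The variational capacity `cap_p(E, Ω)`: the infimum of `∫_Ω g_u^p dμ` over all
`u ∈ N^{1,p}(X)` with `u = 0` on `X \ Ω` and `u ≥ 1` on `E`. -/
noncomputable def varCapacity {X : Type*} [MetricSpace X] [MeasurableSpace X] (p : ℝ)
    (μ : Measure X) (E Ω : Set X) : ℝ≥0∞ :=
  ⨅ (u : X → EReal) (_ : MemNewtonian p μ u) (_ : ∀ x ∉ Ω, u x = 0) (_ : ∀ x ∈ E, 1 ≤ u x),
    energy p μ u Ω

/-- `p`-parabolicity of an unbounded space: `cap_p(B, X) = 0` for all balls `B`. -/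
def IsParabolic {X : Type*} [MetricSpace X] [MeasurableSpace X] (p : ℝ) (μ : Measure X) : Prop :=
  ∀ (x : X) (r : ℝ), 0 < r → varCapacity p μ (Metric.ball x r) univ = 0

/-- `μ` is doubling at `x₀` for large radii. -/
def DoublingAtLarge {X : Type*} [MetricSpace X] [MeasurableSpace X] (μ : Measure X)
    (x₀ : X) : Prop :=
  ∃ R₀ : ℝ, 0 < R₀ ∧ ∃ C : ℝ, 0 < C ∧ ∀ r : ℝ, R₀ ≤ r →
    μ (Metric.ball x₀ (2 * r)) ≤ ENNReal.ofReal C * μ (Metric.ball x₀ r)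

/-- `μ` is reverse-doubling at `x₀` for large radii: there are `ξ, C > 1` with
`μ(B(x₀, ξ r)) ≥ C μ(B(x₀, r))` for all large `r ≤ diam X / (2 ξ)`. -/
def ReverseDoublingAtLarge {X : Type*} [MetricSpace X] [MeasurableSpace X] (μ : Measure X)
    (x₀ : X) : Prop :=
  ∃ R₀ : ℝ, 0 < R₀ ∧ ∃ ξ : ℝ, 1 < ξ ∧ ∃ C : ℝ, 1 < C ∧ ∀ r : ℝ, R₀ ≤ r →
    ENNReal.ofReal (2 * ξ * r) ≤ Metric.ediam (univ : Set X) →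
      ENNReal.ofReal C * μ (Metric.ball x₀ r) ≤ μ (Metric.ball x₀ (ξ * r))

/-- `μ` supports a `q`-Poincaré inequality at `x₀` for large radii: for all large `r`, all
integrable `u` on `X` and all `q`-weak upper gradients `g` of `u`, with `B = B(x₀, r)`,
`⨍_B |u - u_B| dμ ≤ C r (⨍_{lam B} g^q dμ)^{1/q}`. -/
def PoincareAtLarge {X : Type*} [MetricSpace X] [MeasurableSpace X] (q : ℝ) (μ : Measure X)
    (x₀ : X) : Prop :=
  ∃ R₀ : ℝ, 0 < R₀ ∧ ∃ C : ℝ, 0 < C ∧ ∃ lam : ℝ, 1 ≤ lam ∧ ∀ r : ℝ, R₀ ≤ r →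
    ∀ u : X → ℝ, Integrable u μ → ∀ g : X → ℝ≥0∞,
      IsWeakUpperGradient q μ (fun x => (u x : EReal)) g →
        ⨍⁻ x in Metric.ball x₀ r, ‖u x - ⨍ y in Metric.ball x₀ r, u y ∂μ‖ₑ ∂μ ≤
          ENNReal.ofReal (C * r) *
            (⨍⁻ x in Metric.ball x₀ (lam * r), g x ^ q ∂μ) ^ (1 / q)

/-- The integral `∫_{r₀}^∞ (ρ / μ(B(x₀, ρ)))^{1/(p-1)} dρ` in `[0, ∞]`. -/
noncomputable def volumeGrowthIntegral {X : Type*} [MetricSpace X] [MeasurableSpace X] (p : ℝ)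
    (μ : Measure X) (x₀ : X) (r₀ : ℝ) : ℝ≥0∞ :=
  ∫⁻ ρ in Ioi r₀, (ENNReal.ofReal ρ / μ (Metric.ball x₀ ρ)) ^ (1 / (p - 1))

end MetricSobolev

/-! Both directions discretize the growth integral along radii `r k` growing geometrically: up to
constants it is the series `∑ r k * (r k / μ (B k)) ^ (1/(p-1))`, with `B k` the ball of radius `r
k`.

Sufficiency. A decreasing radial function, affine in `d(x, x₀)` on each annulus, has its slope as
upper gradient (`isWeakUpperGradient_radialFun`). Hölder's equality case dictates slopes
proportional to `(r k / μ (B (k+1))) ^ (1/(p-1))`; the resulting capacity bound is `S ^ (1-p)`,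
where `S` is the partial sum of the corresponding series (`varCapacity_ball_le`). If the integral
diverges, then so does `S`, and the capacity vanishes. No doubling is needed.

Necessity. Truncate a competitor to `0 ≤ v ≤ 1`, with `v = 1` on `B 0`. Its averages over `B k`
start at `1` and tend to `0`, since `v` is in `L^p` and reverse doubling forces `μ (B k) → ∞`.
Telescoping bounds `1` by a sum of mean oscillations (`one_le_tsum_oscillation`), which the Poincaré
inequality bounds by means of `g ^ p₀`. Hölder's inequality in `k` separates the weights, whose sum
is controlled by the integral, from `p₀`-means of `g` over nested balls. A discrete Hardy inequality
(`tsum_rpow_setLIntegral_div_le`) bounds the latter by `∫ g ^ p`; it rests on `p₀ < p` and reverse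
doubling. A finite integral thus gives a positive lower bound for the capacity of `B 0`. -/

namespace MetricSobolev

/-! ### Distance to the centre along arc-length curves -/

theorem ArcCurve.lipschitzOnWith {X : Type*} [PseudoEMetricSpace X] (γ : ArcCurve X) :
    LipschitzOnWith 1 γ.toFun (Icc 0 γ.length) := by
  have key : ∀ x ∈ Icc 0 γ.length, ∀ y ∈ Icc 0 γ.length, x ≤ y →
      edist (γ.toFun x) (γ.toFun y) ≤ ((1 : NNReal) : ℝ≥0∞) * edist x y := by
    intro x hx y hy hxy
    have h := γ.unitSpeed hx hy
    have h2 := eVariationOn.edist_le γ.toFun (s := Icc 0 γ.length ∩ Icc x y) (x := x) (y := y)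
      ⟨hx, le_rfl, hxy⟩ ⟨hy, hxy, le_rfl⟩
    rw [h] at h2
    refine h2.trans (le_of_eq ?_)
    rw [edist_comm, edist_dist, Real.dist_eq, abs_of_nonneg (sub_nonneg.2 hxy)]
    simp
  intro x hx y hy
  rcases le_total x y with h | h
  · exact key x hx y hy h
  · rw [edist_comm, edist_comm x y]
    exact key y hy x hx h

theorem ArcCurve.lipschitzOnWith_dist {X : Type*} [MetricSpace X] (γ : ArcCurve X) (x₀ : X) :
    LipschitzOnWith 1 (fun t => dist (γ.toFun t) x₀) (Icc 0 γ.length) := by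
  have h := (LipschitzWith.dist_left x₀).comp_lipschitzOnWith γ.lipschitzOnWith
  simpa [Function.comp_def] using h

/-- A `1`-Lipschitz real function spends at least time `β - α` in `[a, b)` if its end values,
clamped to `[a, b]`, are `α` and `β`. -/
theorem ofReal_abs_clamp_sub_le {D : ℝ → ℝ} {l : ℝ} (hl : 0 ≤ l)
    (hD : LipschitzOnWith 1 D (Icc 0 l)) {a b : ℝ} (hab : a ≤ b) :
    ENNReal.ofReal |max a (min b (D 0)) - max a (min b (D l))| ≤
      volume (Icc 0 l ∩ D ⁻¹' Ico a b) := by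
  set s := max a (min b (D 0)) with hs
  set t := max a (min b (D l)) with ht
  -- Each of these levels lies in `[a, b)` and is attained, by the intermediate value theorem. A
  -- `1`-Lipschitz image is no larger in measure than the set of times mapped onto it.
  have hsub : Ico (min s t) (max s t) ⊆ D '' (Icc 0 l ∩ D ⁻¹' Ico a b) := by
    intro y hy
    have hya : a ≤ y := le_trans (le_min (le_max_left _ _) (le_max_left _ _)) hy.1
    have hyb : y < b := lt_of_lt_of_le hy.2
      (max_le (max_le hab (min_le_left _ _)) (max_le hab (min_le_left _ _)))
    have up : ∀ z, y < max a (min b z) → y ≤ z := by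
      intro z hz
      rcases lt_max_iff.1 hz with h | h
      · exact absurd h (not_lt.2 hya)
      · exact (h.trans_le (min_le_right _ _)).le
    have lo : ∀ z, max a (min b z) ≤ y → z ≤ y := by
      intro z hz
      rcases min_le_iff.1 ((le_max_right _ _).trans hz) with h | h
      · exact absurd hyb (not_lt.2 h)
      · exact h
    have hmem : y ∈ uIcc (D 0) (D l) := by
      rw [mem_uIcc]
      rcases le_total s t with h | h
      · rw [min_eq_left h, max_eq_right h] at hy
        exact Or.inl ⟨lo _ hy.1, up _ hy.2⟩
      · rw [min_eq_right h, max_eq_left h] at hy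
        exact Or.inr ⟨lo _ hy.1, up _ hy.2⟩
    have hc : ContinuousOn D (uIcc 0 l) := by rw [uIcc_of_le hl]; exact hD.continuousOn
    obtain ⟨τ, hτ, rfl⟩ := intermediate_value_uIcc hc hmem
    rw [uIcc_of_le hl] at hτ
    exact ⟨τ, ⟨hτ, hya, hyb⟩, rfl⟩
  calc ENNReal.ofReal |s - t| = volume (Ico (min s t) (max s t)) := by
        rw [Real.volume_Ico, max_sub_min_eq_abs']
    _ ≤ volume (D '' (Icc 0 l ∩ D ⁻¹' Ico a b)) := measure_mono hsub
    _ ≤ volume (Icc 0 l ∩ D ⁻¹' Ico a b) := by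
        have := (hD.mono inter_subset_left).hausdorffMeasure_image_le
          (s := Icc 0 l ∩ D ⁻¹' Ico a b) zero_le_one
        simpa [hausdorffMeasure_real] using this

theorem gap_coe (a b : ℝ) : gap (a : EReal) (b : EReal) = ENNReal.ofReal |a - b| := by
  simp [gap]

theorem AECurve.of_forall {X : Type*} [MetricSpace X] [MeasurableSpace X] {p : ℝ} (hp : 0 < p)
    {μ : Measure X} {P : ArcCurve X → Prop} (h : ∀ γ, P γ) : AECurve p μ P :=
  ⟨0, ⟨aemeasurable_const, fun _ => ⟨1, one_pos, by simp [hp]⟩⟩, fun γ hγ => absurd (h γ) hγ⟩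

/-! ### Radial test functions and upper bounds for the capacity -/

section Radial

variable {X : Type*} [MetricSpace X]

/-- The half-open annulus `{x : a ≤ d(x, x₀) < b}`. -/
def annulus (x₀ : X) (a b : ℝ) : Set X := {x | dist x x₀ ∈ Ico a b}

/-- The decreasing radial function with slope `c k` on the annulus `r k ≤ d(x, x₀) < r (k + 1)`,
`k < N`, which vanishes for `d(x, x₀) ≥ r N`. -/
noncomputable def radialFun (x₀ : X) (r c : ℕ → ℝ) (N : ℕ) (x : X) : ℝ :=
  ∑ k ∈ Finset.range N, c k * (r (k + 1) - max (r k) (min (r (k + 1)) (dist x x₀)))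

/-- The slope of `radialFun`. -/
noncomputable def radialSlope (x₀ : X) (r c : ℕ → ℝ) (N : ℕ) (x : X) : ℝ≥0∞ :=
  ∑ k ∈ Finset.range N, (annulus x₀ (r k) (r (k + 1))).indicator
    (fun _ => ENNReal.ofReal (c k)) x

theorem continuous_radialFun (x₀ : X) (r c : ℕ → ℝ) (N : ℕ) :
    Continuous (radialFun x₀ r c N) := by
  unfold radialFun; fun_prop

theorem radialFun_nonneg (x₀ : X) {r c : ℕ → ℝ} (hr : Monotone r) (hc : ∀ k, 0 ≤ c k) (N : ℕ)
    (x : X) : 0 ≤ radialFun x₀ r c N x :=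
  Finset.sum_nonneg fun k _ => mul_nonneg (hc k)
    (sub_nonneg.2 (max_le (hr (Nat.le_succ k)) (min_le_left _ _)))

theorem radialFun_le (x₀ : X) {r c : ℕ → ℝ} (hc : ∀ k, 0 ≤ c k) (N : ℕ)
    (x : X) : radialFun x₀ r c N x ≤ ∑ k ∈ Finset.range N, c k * (r (k + 1) - r k) :=
  Finset.sum_le_sum fun k _ => mul_le_mul_of_nonneg_left
    (sub_le_sub_left (le_max_left _ _) _) (hc k)

theorem radialFun_eq_of_le (x₀ : X) {r c : ℕ → ℝ} (hr : Monotone r) (N : ℕ)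
    {x : X} (hx : dist x x₀ ≤ r 0) :
    radialFun x₀ r c N x = ∑ k ∈ Finset.range N, c k * (r (k + 1) - r k) := by
  refine Finset.sum_congr rfl fun k _ => ?_
  rw [max_eq_left ((min_le_right _ _).trans (hx.trans (hr (Nat.zero_le k))))]

theorem radialFun_eq_zero (x₀ : X) {r c : ℕ → ℝ} (hr : Monotone r) (N : ℕ)
    {x : X} (hx : r N ≤ dist x x₀) : radialFun x₀ r c N x = 0 := by
  refine Finset.sum_eq_zero fun k hk => ?_
  have : r (k + 1) ≤ dist x x₀ := (hr (Finset.mem_range.1 hk)).trans hx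
  rw [min_eq_left this, max_eq_right (hr (Nat.le_succ k)), sub_self, mul_zero]

variable [MeasurableSpace X] [BorelSpace X]

theorem measurableSet_annulus (x₀ : X) (a b : ℝ) : MeasurableSet (annulus x₀ a b) := by
  have : Measurable fun x : X => dist x x₀ := (continuous_id.dist continuous_const).measurable
  exact this measurableSet_Ico

theorem measurable_radialSlope (x₀ : X) (r c : ℕ → ℝ) (N : ℕ) :
    Measurable (radialSlope x₀ r c N) := by
  unfold radialSlope
  exact Finset.measurable_sum _ fun k _ =>
    measurable_const.indicator (measurableSet_annulus _ _ _)

/-- Expressing the integral through the time spent in each annulus reduces the upper gradient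
inequality to one annulus at a time. -/
theorem arcIntegral_radialSlope (γ : ArcCurve X) (x₀ : X) (r c : ℕ → ℝ) (N : ℕ) :
    arcIntegral γ (radialSlope x₀ r c N) = ∑ k ∈ Finset.range N, ENNReal.ofReal (c k) *
      volume (Icc 0 γ.length ∩ (fun t => dist (γ.toFun t) x₀) ⁻¹' Ico (r k) (r (k + 1))) := by
  have hγ : AEMeasurable γ.toFun (volume.restrict (Icc 0 γ.length)) :=
    γ.lipschitzOnWith.continuousOn.aemeasurable measurableSet_Icc
  have hd : AEMeasurable (fun t => dist (γ.toFun t) x₀) (volume.restrict (Icc 0 γ.length)) :=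
    (γ.lipschitzOnWith_dist x₀).continuousOn.aemeasurable measurableSet_Icc
  unfold arcIntegral radialSlope
  rw [lintegral_finsetSum']
  · refine Finset.sum_congr rfl fun k _ => ?_
    have hns : NullMeasurableSet ((fun t => dist (γ.toFun t) x₀) ⁻¹' Ico (r k) (r (k + 1)))
        (volume.restrict (Icc 0 γ.length)) := hd.nullMeasurableSet_preimage measurableSet_Ico
    have : (fun t => (annulus x₀ (r k) (r (k + 1))).indicator
        (fun _ => ENNReal.ofReal (c k)) (γ.toFun t)) =
        ((fun t => dist (γ.toFun t) x₀) ⁻¹' Ico (r k) (r (k + 1))).indicator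
          (fun _ => ENNReal.ofReal (c k)) := rfl
    rw [this, lintegral_indicator_const₀ hns, Measure.restrict_apply₀ hns, inter_comm]
  · intro k _
    exact (measurable_const.indicator (measurableSet_annulus _ _ _)).comp_aemeasurable hγ

theorem isWeakUpperGradient_radialFun {p : ℝ} (hp : 0 < p) (μ : Measure X) (x₀ : X) {r c : ℕ → ℝ}
    (hr : Monotone r) (hc : ∀ k, 0 ≤ c k) (N : ℕ) :
    IsWeakUpperGradient p μ (fun x => (radialFun x₀ r c N x : EReal)) (radialSlope x₀ r c N) := by
  refine ⟨(measurable_radialSlope x₀ r c N).aemeasurable, AECurve.of_forall hp fun γ => ?_⟩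
  rw [gap_coe, arcIntegral_radialSlope]
  have h1 : |radialFun x₀ r c N γ.source - radialFun x₀ r c N γ.target| ≤
      ∑ k ∈ Finset.range N, c k * |max (r k) (min (r (k + 1)) (dist (γ.toFun 0) x₀)) -
        max (r k) (min (r (k + 1)) (dist (γ.toFun γ.length) x₀))| := by
    unfold radialFun ArcCurve.source ArcCurve.target
    rw [← Finset.sum_sub_distrib]
    refine (Finset.abs_sum_le_sum_abs _ _).trans (Finset.sum_le_sum fun k _ => ?_)
    rw [← mul_sub, abs_mul, abs_of_nonneg (hc k), sub_sub_sub_cancel_left, abs_sub_comm]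
  refine (ENNReal.ofReal_le_ofReal h1).trans ?_
  rw [ENNReal.ofReal_sum_of_nonneg fun k _ => mul_nonneg (hc k) (abs_nonneg _)]
  refine Finset.sum_le_sum fun k _ => ?_
  rw [ENNReal.ofReal_mul (hc k)]
  gcongr
  exact ofReal_abs_clamp_sub_le γ.length_pos.le (γ.lipschitzOnWith_dist x₀) (hr (Nat.le_succ k))

theorem lintegral_radialSlope_rpow_le {p : ℝ} (hp : 0 < p) (μ : Measure X) (x₀ : X) {r c : ℕ → ℝ}
    (hr : Monotone r) (N : ℕ) :
    ∫⁻ x, radialSlope x₀ r c N x ^ p ∂μ ≤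
      ∑ k ∈ Finset.range N, ENNReal.ofReal (c k) ^ p * μ (Metric.ball x₀ (r (k + 1))) := by
  have hpt : ∀ x, radialSlope x₀ r c N x ^ p ≤ ∑ k ∈ Finset.range N,
      (Metric.ball x₀ (r (k + 1))).indicator (fun _ => ENNReal.ofReal (c k) ^ p) x := by
    intro x
    -- The half-open annuli are disjoint, so at most one term of the slope is nonzero and the power
    -- of the sum is a single power. That annulus is then enlarged to a ball.
    by_cases h : ∃ k ∈ Finset.range N, x ∈ annulus x₀ (r k) (r (k + 1))
    · obtain ⟨k, hk, hxk⟩ := h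
      have : radialSlope x₀ r c N x = ENNReal.ofReal (c k) := by
        unfold radialSlope
        rw [Finset.sum_eq_single_of_mem k hk, indicator_of_mem hxk]
        intro j _ hjk
        refine indicator_of_notMem (fun hxj => ?_) _
        rcases lt_or_gt_of_ne hjk with h | h
        · exact absurd (hxj.2.trans_le ((hr h).trans hxk.1)) (lt_irrefl _)
        · exact absurd (hxk.2.trans_le ((hr h).trans hxj.1)) (lt_irrefl _)
      rw [this]
      refine le_trans (le_of_eq ?_) (Finset.single_le_sum (fun _ _ => zero_le) hk)
      rw [indicator_of_mem]
      exact hxk.2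
    · have : radialSlope x₀ r c N x = 0 := by
        refine Finset.sum_eq_zero fun k hk => indicator_of_notMem (fun hx => h ⟨k, hk, hx⟩) _
      rw [this, ENNReal.zero_rpow_of_pos hp]
      exact zero_le
  refine (lintegral_mono hpt).trans (le_of_eq ?_)
  rw [lintegral_finsetSum]
  · refine Finset.sum_congr rfl fun k _ => lintegral_indicator_const measurableSet_ball _
  · exact fun k _ => measurable_const.indicator measurableSet_ball

/-- The normalization `hsum` makes the radial function equal to `1` on the inner ball. It takes
values in `[0, 1]` and vanishes outside a ball of finite measure, hence it is admissible. -/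
theorem varCapacity_ball_le {p : ℝ} (hp : 0 < p) {μ : Measure X} {x₀ : X}
    (hμ : ∀ s : ℝ, μ (Metric.ball x₀ s) < ∞) {r c : ℕ → ℝ}
    (hr : Monotone r) (hc : ∀ k, 0 ≤ c k) (N : ℕ)
    (hsum : ∑ k ∈ Finset.range N, c k * (r (k + 1) - r k) = 1) :
    varCapacity p μ (Metric.ball x₀ (r 0)) univ ≤
      ∑ k ∈ Finset.range N, ENNReal.ofReal (c k) ^ p * μ (Metric.ball x₀ (r (k + 1))) := by
  have hwug := isWeakUpperGradient_radialFun hp μ x₀ hr hc N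
  have hle := lintegral_radialSlope_rpow_le (c := c) hp μ x₀ hr N
  have hfin : ∑ k ∈ Finset.range N, ENNReal.ofReal (c k) ^ p * μ (Metric.ball x₀ (r (k + 1)))
      < ∞ := by
    refine ENNReal.sum_lt_top.2 fun k _ => ENNReal.mul_lt_top ?_ (hμ _)
    exact ENNReal.rpow_lt_top_of_nonneg hp.le ENNReal.ofReal_ne_top
  have hint := hle.trans_lt hfin
  have hmem : MemNewtonian p μ (fun x => (radialFun x₀ r c N x : EReal)) := by
    refine ⟨(measurable_coe_real_ereal.comp
      (continuous_radialFun x₀ r c N).measurable).aemeasurable, ENNReal.add_lt_top.2 ⟨?_, ?_⟩⟩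
    · have : ∀ x, (radialFun x₀ r c N x : EReal).abs ^ p ≤
          (Metric.ball x₀ (r N)).indicator (fun _ => 1) x := by
        intro x
        rw [EReal.abs_def, abs_of_nonneg (radialFun_nonneg x₀ hr hc N x)]
        by_cases hx : x ∈ Metric.ball x₀ (r N)
        · rw [indicator_of_mem hx]
          refine ENNReal.rpow_le_one ?_ hp.le
          rw [← ENNReal.ofReal_one, ← hsum]
          exact ENNReal.ofReal_le_ofReal (radialFun_le x₀ hc N x)
        · rw [radialFun_eq_zero x₀ hr N (not_lt.1 hx)]
          simp [hp]
      refine (lintegral_mono this).trans_lt ?_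
      rw [lintegral_indicator_const measurableSet_ball, one_mul]
      exact hμ _
    · exact (iInf₂_le _ hwug).trans_lt hint
  refine (iInf₂_le_of_le _ hmem <| iInf₂_le_of_le (by simp) ?_ <|
    iInf₂_le_of_le _ hwug <| iInf_le_of_le ⟨hwug.1, fun x => ⟨1, one_pos, ?_⟩⟩ ?_)
  · intro x hx
    simp only [radialFun_eq_of_le x₀ hr N (le_of_lt hx), hsum, EReal.coe_one, le_refl]
  · exact (setLIntegral_le_lintegral _ _).trans_lt hint
  · rw [Measure.restrict_univ]
    exact hle

end Radial

/-! ### Divergence of the growth integral implies parabolicity -/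

theorem setLIntegral_Ioc_le {X : Type*} [MetricSpace X] [MeasurableSpace X] {μ : Measure X}
    {x₀ : X} (hμ : ∀ s : ℝ, 0 < s → 0 < μ (Metric.ball x₀ s) ∧ μ (Metric.ball x₀ s) < ∞)
    {e : ℝ} (he : 0 ≤ e) {a b : ℝ} (ha : 0 < a) (hab : a ≤ b) :
    ∫⁻ ρ in Ioc a b, (ENNReal.ofReal ρ / μ (Metric.ball x₀ ρ)) ^ e ≤
      ENNReal.ofReal ((b / (μ (Metric.ball x₀ a)).toReal) ^ e * (b - a)) := by
  have hm : 0 < (μ (Metric.ball x₀ a)).toReal :=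
    ENNReal.toReal_pos (hμ a ha).1.ne' (hμ a ha).2.ne
  have hb : 0 ≤ b / (μ (Metric.ball x₀ a)).toReal := div_nonneg (ha.le.trans hab) hm.le
  calc ∫⁻ ρ in Ioc a b, (ENNReal.ofReal ρ / μ (Metric.ball x₀ ρ)) ^ e
      ≤ ∫⁻ _ in Ioc a b, (ENNReal.ofReal b / μ (Metric.ball x₀ a)) ^ e := by
        refine setLIntegral_mono' measurableSet_Ioc fun ρ hρ => ?_
        gcongr
        · exact hρ.2
        · exact hρ.1.le
    _ = _ := by
        rw [setLIntegral_const, Real.volume_Ioc, ENNReal.ofReal_mul (by positivity),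
          ← ENNReal.ofReal_rpow_of_nonneg hb he, ENNReal.ofReal_div_of_pos hm,
          ENNReal.ofReal_toReal (hμ a ha).2.ne]

/-- The `k`-th term, whose ball has radius `R * 2 ^ (k + 1)`, is compared with the next annulus
outwards. There `μ (B(x₀, ρ))` is at least the measure of that ball, so doubling is not needed. -/
theorem not_summable_of_volumeGrowthIntegral {X : Type*} [MetricSpace X] [MeasurableSpace X]
    {p : ℝ} (hp : 1 < p) {μ : Measure X} {x₀ : X}
    (hμ : ∀ s : ℝ, 0 < s → 0 < μ (Metric.ball x₀ s) ∧ μ (Metric.ball x₀ s) < ∞)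
    {r₀ : ℝ} (hr₀ : 0 < r₀) (h : volumeGrowthIntegral p μ x₀ r₀ = ∞) {R : ℝ} (hR : r₀ ≤ R) :
    ¬ Summable fun k : ℕ => (R * 2 ^ k) *
      (R * 2 ^ k / (μ (Metric.ball x₀ (R * 2 ^ (k + 1)))).toReal) ^ (1 / (p - 1)) := by
  intro hs
  set e := 1 / (p - 1) with he
  have he0 : 0 ≤ e := by rw [he]; exact one_div_nonneg.2 (by linarith)
  have hR0 : 0 < R := hr₀.trans_le hR
  have hmono : Monotone fun k : ℕ => R * (2 : ℝ) ^ (k + 1) := fun i j hij => by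
    dsimp only; gcongr; norm_num
  have htend : Filter.Tendsto (fun k : ℕ => R * (2 : ℝ) ^ (k + 1)) Filter.atTop Filter.atTop :=
    (((tendsto_pow_atTop_atTop_of_one_lt one_lt_two).comp
      (Filter.tendsto_add_atTop_nat 1))).const_mul_atTop hR0
  have hcover : Ioi r₀ ⊆ Ioc r₀ (R * 2) ∪ ⋃ k : ℕ, Ioc (R * 2 ^ (k + 1)) (R * 2 ^ (k + 1 + 1)) := by
    have hunion := iUnion_Ioc_map_succ_eq_Ioi (f := fun k : ℕ => R * (2 : ℝ) ^ (k + 1))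
      (fun k => hmono bot_le) (Filter.not_bddAbove_of_tendsto_atTop htend)
    simp only [Order.succ_eq_add_one, bot_eq_zero, zero_add, pow_one] at hunion
    rw [hunion]
    exact fun t ht => (le_or_gt t (R * 2)).imp (fun h1 => ⟨ht, h1⟩) id
  -- With `r = R * 2 ^ k`, the annulus has outer radius `4 * r` and width `2 * r`; hence the factor
  -- `2 * 4 ^ e`.
  have hpiece : ∀ k : ℕ, ∫⁻ ρ in Ioc (R * 2 ^ (k + 1)) (R * 2 ^ (k + 1 + 1)),
      (ENNReal.ofReal ρ / μ (Metric.ball x₀ ρ)) ^ e ≤ ENNReal.ofReal (2 * 4 ^ e * ((R * 2 ^ k) *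
        (R * 2 ^ k / (μ (Metric.ball x₀ (R * 2 ^ (k + 1)))).toReal) ^ e)) := by
    intro k
    refine (setLIntegral_Ioc_le hμ he0 (by positivity) (hmono (Nat.le_succ k))).trans
      (ENNReal.ofReal_le_ofReal (le_of_eq ?_))
    change (R * 2 ^ (k + 1 + 1) / _) ^ e * (R * 2 ^ (k + 1 + 1) - R * 2 ^ (k + 1)) = _
    have h4 : R * (2 : ℝ) ^ (k + 1 + 1) = 4 * (R * 2 ^ k) := by ring
    rw [h4, mul_div_assoc, Real.mul_rpow (by norm_num) (by positivity)]
    ring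
  have hlt : volumeGrowthIntegral p μ x₀ r₀ < ∞ := by
    unfold volumeGrowthIntegral
    refine (lintegral_mono_set hcover).trans_lt ((lintegral_union_le _ _ _).trans_lt ?_)
    refine ENNReal.add_lt_top.2 ⟨?_, ?_⟩
    · exact (setLIntegral_Ioc_le hμ he0 hr₀ (by linarith)).trans_lt ENNReal.ofReal_lt_top
    · refine (lintegral_iUnion_le _ _).trans_lt ((ENNReal.tsum_le_tsum hpiece).trans_lt ?_)
      rw [← ENNReal.ofReal_tsum_of_nonneg (fun k => by positivity) (hs.mul_left _)]
      exact ENNReal.ofReal_lt_top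
  exact hlt.ne h

theorem isParabolic_of_volumeGrowthIntegral_eq_top {X : Type*} [MetricSpace X] [MeasurableSpace X]
    [BorelSpace X] {p : ℝ} (hp : 1 < p) {μ : Measure X} {x₀ : X}
    (hμ : ∀ s : ℝ, 0 < s → 0 < μ (Metric.ball x₀ s) ∧ μ (Metric.ball x₀ s) < ∞)
    {r₀ : ℝ} (hr₀ : 0 < r₀) (h : volumeGrowthIntegral p μ x₀ r₀ = ∞) : IsParabolic p μ := by
  intro x s hs
  set R := max r₀ (s + dist x x₀) with hRdef
  have hR : r₀ ≤ R := le_max_left _ _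
  have hR0 : 0 < R := hr₀.trans_le hR
  have hsub : Metric.ball x s ⊆ Metric.ball x₀ R := by
    refine Metric.ball_subset_ball' (le_max_right _ _)
  set e := 1 / (p - 1) with he
  set r : ℕ → ℝ := fun k => R * 2 ^ k with hrdef
  have hrpos : ∀ k, 0 < r k := fun k => by positivity
  have hmono : Monotone r := fun i j hij => by
    simp only [hrdef]; gcongr; norm_num
  have hfin : ∀ s : ℝ, μ (Metric.ball x₀ s) < ∞ := fun s => by
    rcases le_or_gt s 0 with h0 | h0
    · rw [Metric.ball_eq_empty.2 h0]; simp
    · exact (hμ s h0).2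
  set m : ℕ → ℝ := fun k => (μ (Metric.ball x₀ (r (k + 1)))).toReal with hm
  have hmpos : ∀ k, 0 < m k := fun k =>
    ENNReal.toReal_pos (hμ _ (hrpos _)).1.ne' (hμ _ (hrpos _)).2.ne
  set w : ℕ → ℝ := fun k => r k * (r k / m k) ^ e with hw
  have hwpos : ∀ k, 0 < w k := fun k =>
    mul_pos (hrpos k) (Real.rpow_pos_of_pos (div_pos (hrpos k) (hmpos k)) _)
  have hns : ¬ Summable w := not_summable_of_volumeGrowthIntegral hp hμ hr₀ h hR
  have htop := (not_summable_iff_tendsto_nat_atTop_of_nonneg fun k => (hwpos k).le).1 hns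
  have hbound : ∀ N : ℕ, 0 < N → varCapacity p μ (Metric.ball x s) univ ≤
      ENNReal.ofReal ((∑ k ∈ Finset.range N, w k) ^ (-(p - 1))) := by
    intro N hN
    set S := ∑ k ∈ Finset.range N, w k with hS
    have hSpos : 0 < S := Finset.sum_pos (fun k _ => hwpos k) ⟨0, Finset.mem_range.2 hN⟩
    -- This choice minimizes `∑ c k ^ p * m k` under the constraint `∑ c k * r k = 1`, where `r k =
    -- r (k + 1) - r k` by dyadicity. Since `e * p = 1 + e`, the minimum is `S ^ (1 - p)`.
    set c : ℕ → ℝ := fun k => (r k / m k) ^ e / S with hc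
    have hcpos : ∀ k, 0 ≤ c k := fun k =>
      div_nonneg (Real.rpow_nonneg (div_pos (hrpos k) (hmpos k)).le _) hSpos.le
    have hsum : ∑ k ∈ Finset.range N, c k * (r (k + 1) - r k) = 1 := by
      have : ∀ k, c k * (r (k + 1) - r k) = w k / S := fun k => by
        simp only [hc, hw, hrdef]; ring
      simp_rw [this]
      rw [← Finset.sum_div, ← hS, div_self hSpos.ne']
    have hcap := varCapacity_ball_le (by linarith : 0 < p) hfin hmono hcpos N hsum
    have hterm : ∀ k, ENNReal.ofReal (c k) ^ p * μ (Metric.ball x₀ (r (k + 1))) =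
        ENNReal.ofReal (w k / S ^ p) := by
      intro k
      rw [ENNReal.ofReal_rpow_of_nonneg (hcpos k) (by linarith),
        ← ENNReal.ofReal_toReal (hfin (r (k + 1))).ne,
        ← ENNReal.ofReal_mul (Real.rpow_nonneg (hcpos k) _)]
      congr 1
      have hq : 0 < r k / m k := div_pos (hrpos k) (hmpos k)
      have hep : e * p = 1 + e := by
        rw [he]; have : p - 1 ≠ 0 := by linarith
        field_simp; ring
      change c k ^ p * m k = _
      simp only [hc, hw]
      rw [Real.div_rpow (Real.rpow_nonneg hq.le _) hSpos.le, ← Real.rpow_mul hq.le, hep,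
        Real.rpow_add hq, Real.rpow_one]
      have := (hmpos k).ne'
      field_simp
    have hmono_cap : varCapacity p μ (Metric.ball x s) univ ≤
        varCapacity p μ (Metric.ball x₀ (r 0)) univ := by
      refine le_iInf₂ fun u hu => le_iInf₂ fun h0 h1 => iInf₂_le_of_le u hu <|
        iInf₂_le_of_le h0 (fun y hy => h1 y ?_) le_rfl
      simpa [hrdef] using hsub hy
    refine hmono_cap.trans (hcap.trans (le_of_eq ?_))
    simp_rw [hterm]
    rw [← ENNReal.ofReal_sum_of_nonneg fun k _ =>
      div_nonneg (hwpos k).le (Real.rpow_nonneg hSpos.le _), ← Finset.sum_div, ← hS]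
    congr 1
    rw [neg_sub, Real.rpow_sub hSpos, Real.rpow_one]
  have hlim : Filter.Tendsto
      (fun N : ℕ => ENNReal.ofReal ((∑ k ∈ Finset.range N, w k) ^ (-(p - 1))))
      Filter.atTop (nhds 0) := by
    rw [← ENNReal.ofReal_zero]
    exact ENNReal.tendsto_ofReal ((tendsto_rpow_neg_atTop (by linarith : 0 < p - 1)).comp htop)
  refine le_antisymm (ge_of_tendsto hlim ?_) zero_le
  filter_upwards [Filter.eventually_gt_atTop 0] with N hN using hbound N hN

/-! ### Changing exponents, truncation and localization of the Poincaré inequality -/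

/-- Hölder's inequality against the constant function `1`, for exponents `p₀ < p`. -/
theorem setLIntegral_rpow_le {X : Type*} [MeasurableSpace X] {μ : Measure X} {f : X → ℝ≥0∞}
    (hf : AEMeasurable f μ) {p₀ p : ℝ} (hp₀ : 0 < p₀) (hp : p₀ < p) (A : Set X) :
    ∫⁻ x in A, f x ^ p₀ ∂μ ≤ (∫⁻ x in A, f x ^ p ∂μ) ^ (p₀ / p) * μ A ^ (1 - p₀ / p) := by
  have hp' : 0 < p := hp₀.trans hp
  have hconj : (p / p₀).HolderConjugate (1 - p₀ / p)⁻¹ := by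
    rw [Real.holderConjugate_iff]
    refine ⟨(one_lt_div hp₀).2 hp, ?_⟩
    rw [inv_inv, inv_div]; ring
  have h := ENNReal.lintegral_mul_le_Lp_mul_Lq (μ.restrict A) hconj
    (f := fun x => f x ^ p₀) (g := fun _ => 1) (hf.restrict.pow_const p₀) aemeasurable_const
  simp only [Pi.mul_apply, mul_one, ENNReal.one_rpow, lintegral_const, one_mul,
    Measure.restrict_apply_univ, one_div, inv_inv, inv_div] at h
  simpa only [← ENNReal.rpow_mul, mul_div_cancel₀ p hp₀.ne'] using h

/-- Balls have finite measure, so `L^p_loc` is contained in `L^p₀_loc` and the same `ρ` witnesses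
the exceptional curve family. -/
theorem IsWeakUpperGradient.mono_exponent {X : Type*} [MetricSpace X] [MeasurableSpace X]
    {μ : Measure X} (hμ : ∀ (x : X) (r : ℝ), μ (Metric.ball x r) < ∞)
    {p₀ p : ℝ} (hp₀ : 0 < p₀) (hp : p₀ < p) {u : X → EReal} {g : X → ℝ≥0∞}
    (h : IsWeakUpperGradient p μ u g) : IsWeakUpperGradient p₀ μ u g := by
  obtain ⟨hg, ρ, ⟨hρ, hloc⟩, hcurve⟩ := h
  refine ⟨hg, ρ, ⟨hρ, fun x => ?_⟩, hcurve⟩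
  obtain ⟨r, hr, hint⟩ := hloc x
  refine ⟨r, hr, (setLIntegral_rpow_le hρ hp₀ hp _).trans_lt (ENNReal.mul_lt_top ?_ ?_)⟩
  · exact ENNReal.rpow_lt_top_of_nonneg (div_pos hp₀ (hp₀.trans hp)).le hint.ne
  · exact ENNReal.rpow_lt_top_of_nonneg
      (sub_nonneg.2 ((div_le_one (hp₀.trans hp)).2 hp.le)) (hμ x r).ne

theorem AECurve.mono {X : Type*} [MetricSpace X] [MeasurableSpace X] {p : ℝ} {μ : Measure X}
    {P Q : ArcCurve X → Prop} (h : AECurve p μ P) (hPQ : ∀ γ, P γ → Q γ) : AECurve p μ Q := by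
  obtain ⟨ρ, hρ, hcurve⟩ := h
  exact ⟨ρ, hρ, fun γ hγ => hcurve γ fun hP => hγ (hPQ γ hP)⟩

/-- Truncation of an extended real number to the interval `[0, 1]`. -/
noncomputable def unitClamp (a : EReal) : ℝ := (max 0 (min 1 a)).toReal

theorem coe_unitClamp (a : EReal) : (unitClamp a : EReal) = max 0 (min 1 a) := by
  refine EReal.coe_toReal (ne_of_lt ?_) (ne_of_gt ?_)
  · exact max_lt EReal.zero_lt_top ((min_le_left _ _).trans_lt (EReal.coe_lt_top 1))
  · exact EReal.bot_lt_zero.trans_le (le_max_left _ _)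

theorem unitClamp_nonneg (a : EReal) : 0 ≤ unitClamp a :=
  EReal.toReal_nonneg (le_max_left _ _)

theorem unitClamp_le_one (a : EReal) : unitClamp a ≤ 1 := by
  rw [← EReal.coe_le_coe_iff, coe_unitClamp]
  exact max_le zero_le_one (min_le_left _ _)

theorem unitClamp_of_one_le {a : EReal} (ha : 1 ≤ a) : unitClamp a = 1 := by
  rw [← EReal.coe_eq_coe_iff, coe_unitClamp, min_eq_left ha, max_eq_right zero_le_one]; rfl

theorem unitClamp_coe (a : ℝ) : unitClamp a = max 0 (min 1 a) := by
  have hmono : Monotone Real.toEReal := fun _ _ h => EReal.coe_le_coe_iff.2 h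
  rw [← EReal.coe_eq_coe_iff, coe_unitClamp, hmono.map_max, hmono.map_min, EReal.coe_zero,
    EReal.coe_one]

theorem measurable_unitClamp : Measurable unitClamp :=
  (measurable_const.max (measurable_const.min measurable_id)).ereal_toReal

theorem ofReal_unitClamp_le (a : EReal) : ENNReal.ofReal (unitClamp a) ≤ a.abs := by
  induction a with
  | bot => simp
  | top => simp
  | coe a =>
    rw [EReal.abs_def, unitClamp_coe]
    exact ENNReal.ofReal_le_ofReal
      (max_le (abs_nonneg a) ((min_le_right _ _).trans (le_abs_self a)))

theorem gap_unitClamp_le (a b : EReal) : gap (unitClamp a) (unitClamp b) ≤ gap a b := by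
  by_cases h : a = ⊤ ∨ a = ⊥ ∨ b = ⊤ ∨ b = ⊥
  · rw [gap.eq_1 a b, if_pos h]; exact le_top
  · push Not at h
    lift a to ℝ using ⟨h.1, h.2.1⟩
    lift b to ℝ using ⟨h.2.2.1, h.2.2.2⟩
    rw [gap_coe, gap_coe, unitClamp_coe, unitClamp_coe]
    rw [max_comm 0, max_comm 0]
    refine ENNReal.ofReal_le_ofReal ((abs_max_sub_max_le_abs _ _ _).trans ?_)
    simpa using abs_min_sub_min_le_max 1 a 1 b

theorem IsWeakUpperGradient.unitClamp {X : Type*} [MetricSpace X] [MeasurableSpace X]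
    {p : ℝ} {μ : Measure X} {u : X → EReal} {g : X → ℝ≥0∞}
    (h : IsWeakUpperGradient p μ u g) :
    IsWeakUpperGradient p μ (fun x => (unitClamp (u x) : EReal)) g :=
  ⟨h.1, h.2.mono fun _ hγ => (gap_unitClamp_le _ _).trans hγ⟩

/-- A function may be cut off outside a ball if its weak upper gradient is set to `∞` outside a
smaller closed ball. -/
theorem IsWeakUpperGradient.indicator_ball {X : Type*} [MetricSpace X] [MeasurableSpace X]
    [BorelSpace X] {p : ℝ} {μ : Measure X} {v : X → ℝ} {g : X → ℝ≥0∞}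
    (h : IsWeakUpperGradient p μ (fun x => (v x : EReal)) g) (x₀ : X) {s t : ℝ} (hst : s < t) :
    IsWeakUpperGradient p μ (fun x => (((Metric.ball x₀ t).indicator v x : ℝ) : EReal))
      (g + (Metric.closedBall x₀ s)ᶜ.indicator fun _ => ∞) := by
  refine ⟨h.1.add (measurable_const.indicator
    Metric.isClosed_closedBall.measurableSet.compl).aemeasurable, h.2.mono fun γ hγ => ?_⟩
  by_cases hin : ∀ τ ∈ Icc 0 γ.length, γ.toFun τ ∈ Metric.ball x₀ t
  · have h0 : γ.source ∈ Metric.ball x₀ t := hin 0 ⟨le_rfl, γ.length_pos.le⟩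
    have h1 : γ.target ∈ Metric.ball x₀ t := hin _ ⟨γ.length_pos.le, le_rfl⟩
    simp only [indicator_of_mem h0, indicator_of_mem h1]
    refine hγ.trans (lintegral_mono fun τ => le_self_add)
  · push Not at hin
    obtain ⟨τ, hτ, hout⟩ := hin
    -- At time `τ` the curve is at distance at least `t` from `x₀`; being `1`-Lipschitz, it stays
    -- outside the closed `s`-ball for times within `t - s` of `τ`. The value `∞` is then collected
    -- on a set of positive length.
    suffices arcIntegral γ (g + (Metric.closedBall x₀ s)ᶜ.indicator fun _ => ∞) = ∞ by
      rw [this]; exact le_top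
    have hD := γ.lipschitzOnWith_dist x₀
    have hτt : t ≤ dist (γ.toFun τ) x₀ := not_lt.1 hout
    set δ := t - s with hδ
    have hδ0 : 0 < δ := sub_pos.2 hst
    have hsub : ∀ σ ∈ Icc 0 γ.length ∩ Ioo (τ - δ) (τ + δ),
        γ.toFun σ ∉ Metric.closedBall x₀ s := by
      intro σ hσ hc
      have h1 := hD.dist_le_mul τ hτ σ hσ.1
      rw [Real.dist_eq, Real.dist_eq] at h1
      have h2 : |τ - σ| < δ := by rw [abs_lt]; constructor <;> linarith [hσ.2.1, hσ.2.2]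
      have h3 := le_abs_self (dist (γ.toFun τ) x₀ - dist (γ.toFun σ) x₀)
      have h4 : dist (γ.toFun σ) x₀ ≤ s := hc
      simp only [NNReal.coe_one, one_mul] at h1
      linarith
    have hvol : volume (Icc 0 γ.length ∩ Ioo (τ - δ) (τ + δ)) ≠ 0 := by
      have hI : Ioo (max 0 (τ - δ)) (min γ.length (τ + δ)) ⊆
          Icc 0 γ.length ∩ Ioo (τ - δ) (τ + δ) := fun σ hσ =>
        ⟨⟨(le_max_left _ _).trans hσ.1.le, hσ.2.le.trans (min_le_left _ _)⟩,
          (le_max_right _ _).trans_lt hσ.1, hσ.2.trans_le (min_le_right _ _)⟩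
      have hlt : max 0 (τ - δ) < min γ.length (τ + δ) :=
        max_lt (lt_min γ.length_pos (by linarith [hτ.1]))
          (lt_min (by linarith [hτ.2]) (by linarith))
      refine ((?_ : 0 < volume _).trans_le (measure_mono hI)).ne'
      rw [Real.volume_Ioo, ENNReal.ofReal_pos]
      linarith
    rw [eq_top_iff]
    calc (∞ : ℝ≥0∞) = ∫⁻ _ in Icc 0 γ.length ∩ Ioo (τ - δ) (τ + δ), ∞ := by
          rw [setLIntegral_const, ENNReal.top_mul hvol]
      _ ≤ ∫⁻ σ in Icc 0 γ.length ∩ Ioo (τ - δ) (τ + δ),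
          (g + (Metric.closedBall x₀ s)ᶜ.indicator fun _ => ∞) (γ.toFun σ) := by
          refine setLIntegral_mono' (measurableSet_Icc.inter measurableSet_Ioo) fun σ hσ => ?_
          rw [Pi.add_apply, indicator_of_mem (mem_compl (hsub σ hσ)), add_top]
      _ ≤ _ := lintegral_mono_set inter_subset_left

/-- A Poincaré inequality for integrable functions localizes to bounded functions. -/
theorem poincare_of_bounded {X : Type*} [MetricSpace X] [MeasurableSpace X] [BorelSpace X]
    {μ : Measure X} {x₀ : X} {q r C lam : ℝ}
    (hμ : ∀ s : ℝ, μ (Metric.ball x₀ s) < ∞) (hr : 0 ≤ r) (hlam : 1 ≤ lam)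
    (hP : ∀ u : X → ℝ, Integrable u μ → ∀ g : X → ℝ≥0∞,
      IsWeakUpperGradient q μ (fun x => (u x : EReal)) g →
        ⨍⁻ x in Metric.ball x₀ r, ‖u x - ⨍ y in Metric.ball x₀ r, u y ∂μ‖ₑ ∂μ ≤
          ENNReal.ofReal (C * r) * (⨍⁻ x in Metric.ball x₀ (lam * r), g x ^ q ∂μ) ^ (1 / q))
    {v : X → ℝ} (hv : AEMeasurable v μ) {M : ℝ} (hM : ∀ x, |v x| ≤ M) {g : X → ℝ≥0∞}
    (hg : IsWeakUpperGradient q μ (fun x => (v x : EReal)) g) :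
    ⨍⁻ x in Metric.ball x₀ r, ‖v x - ⨍ y in Metric.ball x₀ r, v y ∂μ‖ₑ ∂μ ≤
      ENNReal.ofReal (C * r) * (⨍⁻ x in Metric.ball x₀ (lam * r), g x ^ q ∂μ) ^ (1 / q) := by
  -- The cutoff makes `v` integrable. It changes neither side, because both only involve the ball of
  -- radius `lam * r`; any larger cutoff radius would serve.
  have hst : lam * r < lam * r + 1 := lt_add_one _
  have hint : Integrable ((Metric.ball x₀ (lam * r + 1)).indicator v) μ := by
    rw [integrable_indicator_iff measurableSet_ball]
    exact Measure.integrableOn_of_bounded (hμ _).ne hv.aestronglyMeasurable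
      (ae_of_all _ fun x => hM x)
  have h := hP _ hint _ (hg.indicator_ball x₀ hst)
  have hsub : Metric.ball x₀ r ⊆ Metric.ball x₀ (lam * r + 1) :=
    Metric.ball_subset_ball (by nlinarith)
  have e1 : ⨍ y in Metric.ball x₀ r, (Metric.ball x₀ (lam * r + 1)).indicator v y ∂μ =
      ⨍ y in Metric.ball x₀ r, v y ∂μ := by
    rw [setAverage_eq, setAverage_eq]
    congr 1
    exact setIntegral_congr_fun measurableSet_ball fun x hx => indicator_of_mem (hsub hx) v
  have e2 : ⨍⁻ x in Metric.ball x₀ r, ‖(Metric.ball x₀ (lam * r + 1)).indicator v x -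
      ⨍ y in Metric.ball x₀ r, v y ∂μ‖ₑ ∂μ =
      ⨍⁻ x in Metric.ball x₀ r, ‖v x - ⨍ y in Metric.ball x₀ r, v y ∂μ‖ₑ ∂μ := by
    rw [setLAverage_eq, setLAverage_eq]
    congr 1
    exact setLIntegral_congr_fun measurableSet_ball fun x hx => by
      simp only [indicator_of_mem (hsub hx)]
  have e3 : ⨍⁻ x in Metric.ball x₀ (lam * r),
      (g + (Metric.closedBall x₀ (lam * r))ᶜ.indicator fun _ => ∞) x ^ q ∂μ =
      ⨍⁻ x in Metric.ball x₀ (lam * r), g x ^ q ∂μ := by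
    rw [setLAverage_eq, setLAverage_eq]
    congr 1
    exact setLIntegral_congr_fun measurableSet_ball fun x hx => by
      rw [Pi.add_apply, indicator_of_notMem (notMem_compl_iff.2
        (Metric.ball_subset_closedBall hx)), add_zero]
  rwa [e1, e2, e3] at h

/-! ### Discrete Hardy inequality and averages over growing balls -/

/-- Convexity of the `q`-th power is applied to `θ * Y k + w * (w⁻¹ * e k)`, so that `Y k ^ q` keeps
the factor `θ < 1`. The extra term `Y N ^ q` on the left lets the induction close. -/
theorem sum_rpow_le_of_le_mul_add {θ w : ℝ≥0∞} (hw : w ≠ 0) (hθ : θ + w = 1) {q : ℝ} (hq : 1 ≤ q)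
    {Y e : ℕ → ℝ≥0∞} (h : ∀ k, Y (k + 1) ≤ θ * Y k + e k) (N : ℕ) :
    w * ∑ k ∈ Finset.range N, Y k ^ q + Y N ^ q ≤
      Y 0 ^ q + w * w⁻¹ ^ q * ∑ k ∈ Finset.range N, e k ^ q := by
  have hw' : w ≠ ∞ := fun h => by simp [h] at hθ
  have hq0 : 0 ≤ q := zero_le_one.trans hq
  induction N with
  | zero => simp
  | succ N ih =>
    have hstep : Y (N + 1) ^ q ≤ θ * Y N ^ q + w * w⁻¹ ^ q * e N ^ q := by
      refine (ENNReal.rpow_le_rpow (h N) hq0).trans ?_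
      have h1 : e N = w * (w⁻¹ * e N) := by
        rw [← mul_assoc, ENNReal.mul_inv_cancel hw hw', one_mul]
      rw [h1]
      refine (ENNReal.rpow_arith_mean_le_arith_mean2_rpow θ w _ _ hθ hq).trans (le_of_eq ?_)
      rw [← h1, ENNReal.mul_rpow_of_nonneg _ _ hq0, mul_assoc]
    rw [Finset.sum_range_succ, Finset.sum_range_succ, mul_add, mul_add, ← add_assoc]
    calc w * ∑ k ∈ Finset.range N, Y k ^ q + w * Y N ^ q + Y (N + 1) ^ q
        ≤ w * ∑ k ∈ Finset.range N, Y k ^ q + w * Y N ^ q +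
          (θ * Y N ^ q + w * w⁻¹ ^ q * e N ^ q) := by gcongr
      _ = w * ∑ k ∈ Finset.range N, Y k ^ q + (θ + w) * Y N ^ q + w * w⁻¹ ^ q * e N ^ q := by ring
      _ ≤ _ := by rw [hθ, one_mul]; gcongr

section Balls

variable {X : Type*} [MeasurableSpace X] {μ : Measure X}

theorem sum_setLIntegral_diff_le {B : ℕ → Set X} (hB : Monotone B)
    (hBm : ∀ k, MeasurableSet (B k)) (f : X → ℝ≥0∞) (N : ℕ) :
    ∑ k ∈ Finset.range N, ∫⁻ x in B (k + 1) \ B k, f x ∂μ ≤ ∫⁻ x in B N, f x ∂μ := by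
  induction N with
  | zero => simp
  | succ N ih =>
    rw [Finset.sum_range_succ]
    refine (add_le_add_left ih _).trans (le_of_eq ?_)
    rw [← lintegral_inter_add_sdiff f (B (N + 1)) (hBm N), inter_eq_right.2 (hB (Nat.le_succ N))]

/-- A discrete Hardy type inequality along balls with geometrically growing measures. -/
theorem tsum_rpow_setLIntegral_div_le {B : ℕ → Set X} (hB : Monotone B)
    (hBm : ∀ k, MeasurableSet (B k)) (hB0 : ∀ k, μ (B k) ≠ 0) (hBt : ∀ k, μ (B k) ≠ ∞)
    {c : ℝ≥0∞} (hc1 : 1 < c) (hc : ∀ k, c * μ (B k) ≤ μ (B (k + 1)))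
    {p₀ p : ℝ} (hp₀ : 0 < p₀) (hp : p₀ < p) :
    ∃ M : ℝ≥0∞, M ≠ ∞ ∧ ∀ g : X → ℝ≥0∞, AEMeasurable g μ →
      ∑' k, ((∫⁻ x in B k, g x ^ p₀ ∂μ) / μ (B k) ^ (1 - p₀ / p)) ^ (p / p₀) ≤
        M * ∫⁻ x, g x ^ p ∂μ := by
  have hp' : 0 < p := hp₀.trans hp
  set s := 1 - p₀ / p with hs
  have hs0 : 0 < s := sub_pos.2 ((div_lt_one hp').2 hp)
  have hq : 1 ≤ p / p₀ := (one_le_div hp₀).2 hp.le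
  have hq0 : 0 ≤ p / p₀ := zero_le_one.trans hq
  -- Here `p₀ < p` enters: `s > 0` makes the contraction factor of the recursion below strictly less
  -- than `1`.
  have hcs : (c ^ s)⁻¹ < 1 := ENNReal.inv_lt_one.2 (ENNReal.one_lt_rpow hc1 hs0)
  set w := 1 - (c ^ s)⁻¹ with hw
  have hw0 : w ≠ 0 := (tsub_pos_of_lt hcs).ne'
  have hwt : w ≠ ∞ := ENNReal.sub_ne_top ENNReal.one_ne_top
  have hθ : (c ^ s)⁻¹ + w = 1 := add_tsub_cancel_of_le hcs.le
  have hm0 : ∀ k, μ (B k) ^ s ≠ 0 := fun k =>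
    (ENNReal.rpow_pos_of_nonneg (pos_iff_ne_zero.2 (hB0 k)) hs0.le).ne'
  have hmt : ∀ k, μ (B k) ^ s ≠ ∞ := fun k => ENNReal.rpow_ne_top_of_nonneg hs0.le (hBt k)
  refine ⟨w⁻¹ * (1 + w * w⁻¹ ^ (p / p₀)), ?_, fun g hg => ?_⟩
  · exact ENNReal.mul_ne_top (ENNReal.inv_ne_top.2 hw0) (ENNReal.add_ne_top.2
      ⟨ENNReal.one_ne_top, ENNReal.mul_ne_top hwt
        (ENNReal.rpow_ne_top_of_nonneg hq0 (ENNReal.inv_ne_top.2 hw0))⟩)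
  set Y : ℕ → ℝ≥0∞ := fun k => (∫⁻ x in B k, g x ^ p₀ ∂μ) / μ (B k) ^ s with hY
  set e : ℕ → ℝ≥0∞ := fun k => (∫⁻ x in B (k + 1) \ B k, g x ^ p ∂μ) ^ (p₀ / p) with he
  have hcancel : ∀ a : ℝ≥0∞, (a ^ (p₀ / p)) ^ (p / p₀) = a := fun a => by
    rw [← ENNReal.rpow_mul, div_mul_div_cancel₀ hp'.ne', div_self hp₀.ne', ENNReal.rpow_one]
  -- The part of the integral over `B k` contracts because the normalizing measure grows by `c`; the
  -- annulus is estimated by Hölder. The annuli are disjoint, so the powers `e k ^ (p / p₀)` sum to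
  -- at most `∫ g ^ p`.
  have hrec : ∀ k, Y (k + 1) ≤ (c ^ s)⁻¹ * Y k + e k := by
    intro k
    have h1 : ∫⁻ x in B (k + 1), g x ^ p₀ ∂μ ≤
        ∫⁻ x in B k, g x ^ p₀ ∂μ + e k * μ (B (k + 1)) ^ s := by
      rw [← lintegral_inter_add_sdiff _ (B (k + 1)) (hBm k), inter_eq_right.2 (hB (Nat.le_succ k))]
      gcongr
      refine (setLIntegral_rpow_le hg hp₀ hp _).trans ?_
      gcongr
      exact sdiff_subset
    calc Y (k + 1) ≤ (∫⁻ x in B k, g x ^ p₀ ∂μ + e k * μ (B (k + 1)) ^ s) / μ (B (k + 1)) ^ s := by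
          simp only [hY]; gcongr
      _ = (∫⁻ x in B k, g x ^ p₀ ∂μ) / μ (B (k + 1)) ^ s + e k := by
          rw [ENNReal.add_div, ENNReal.mul_div_cancel_right (hm0 _) (hmt _)]
      _ ≤ (∫⁻ x in B k, g x ^ p₀ ∂μ) / (c * μ (B k)) ^ s + e k := by
          gcongr; exact hc k
      _ = _ := by
          rw [ENNReal.mul_rpow_of_nonneg _ _ hs0.le, div_eq_mul_inv,
            ENNReal.mul_inv (Or.inr (hmt k)) (Or.inr (hm0 k))]
          simp only [hY, div_eq_mul_inv]
          ring
  have hY0 : Y 0 ^ (p / p₀) ≤ ∫⁻ x, g x ^ p ∂μ := by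
    have h1 : Y 0 ≤ (∫⁻ x in B 0, g x ^ p ∂μ) ^ (p₀ / p) :=
      ENNReal.div_le_of_le_mul (setLIntegral_rpow_le hg hp₀ hp _)
    refine (ENNReal.rpow_le_rpow h1 hq0).trans ?_
    rw [hcancel]
    exact setLIntegral_le_lintegral _ _
  rw [ENNReal.tsum_eq_iSup_nat]
  refine iSup_le fun N => ?_
  have hsum := (le_self_add.trans (sum_rpow_le_of_le_mul_add hw0 hθ hq hrec N))
  have hE : ∑ k ∈ Finset.range N, e k ^ (p / p₀) ≤ ∫⁻ x, g x ^ p ∂μ := by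
    simp only [he, hcancel]
    exact (sum_setLIntegral_diff_le hB hBm _ N).trans (setLIntegral_le_lintegral _ _)
  calc ∑ k ∈ Finset.range N, Y k ^ (p / p₀)
      = w⁻¹ * (w * ∑ k ∈ Finset.range N, Y k ^ (p / p₀)) := by
        rw [← mul_assoc, ENNReal.inv_mul_cancel hw0 hwt, one_mul]
    _ ≤ w⁻¹ * (∫⁻ x, g x ^ p ∂μ + w * w⁻¹ ^ (p / p₀) * ∫⁻ x, g x ^ p ∂μ) := by
        gcongr
        exact hsum.trans (by gcongr)
    _ = _ := by ring

theorem enorm_setAverage_sub_le {A : Set X} (hA0 : μ A ≠ 0) (hAt : μ A ≠ ∞) {v : X → ℝ}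
    (hv : IntegrableOn v A μ) (a : ℝ) :
    ‖(⨍ x in A, v x ∂μ) - a‖ₑ ≤ ⨍⁻ x in A, ‖v x - a‖ₑ ∂μ := by
  have : Fact (μ A < ∞) := ⟨hAt.lt_top⟩
  have : NeZero (μ.restrict A) := ⟨fun h => hA0 (Measure.restrict_eq_zero.1 h)⟩
  have h1 : ⨍ x in A, (v x - a) ∂μ = (⨍ x in A, v x ∂μ) - a := by
    rw [setAverage_eq, integral_sub hv (integrable_const a), smul_sub, ← setAverage_eq,
      ← setAverage_eq, average_const]
  rw [← h1]
  exact enorm_integral_le_lintegral_enorm _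

/-- The two averages differ by at most the mean over `A` of the deviation from the average over
`A'`; enlarging `A` to `A'` costs the factor `D`. -/
theorem enorm_setAverage_le_add {A A' : Set X} (hsub : A ⊆ A') (hA0 : μ A ≠ 0) (hAt : μ A ≠ ∞)
    (hAt' : μ A' ≠ ∞) {D : ℝ≥0∞} (hD : μ A' ≤ D * μ A) {v : X → ℝ} (hv : IntegrableOn v A μ) :
    ‖⨍ x in A, v x ∂μ‖ₑ ≤ ‖⨍ x in A', v x ∂μ‖ₑ +
      D * ⨍⁻ x in A', ‖v x - ⨍ y in A', v y ∂μ‖ₑ ∂μ := by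
  set a := ⨍ x in A', v x ∂μ with ha
  have hA0' : μ A' ≠ 0 := fun h => hA0 (measure_mono_null hsub h)
  calc ‖⨍ x in A, v x ∂μ‖ₑ = ‖a + ((⨍ x in A, v x ∂μ) - a)‖ₑ := by rw [add_sub_cancel]
    _ ≤ ‖a‖ₑ + ‖(⨍ x in A, v x ∂μ) - a‖ₑ := enorm_add_le _ _
    _ ≤ ‖a‖ₑ + ⨍⁻ x in A, ‖v x - a‖ₑ ∂μ := by gcongr; exact enorm_setAverage_sub_le hA0 hAt hv a
    _ ≤ _ := by
      gcongr
      rw [setLAverage_eq, setLAverage_eq, div_eq_mul_inv, div_eq_mul_inv]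
      calc (∫⁻ x in A, ‖v x - a‖ₑ ∂μ) * (μ A)⁻¹ ≤ (∫⁻ x in A', ‖v x - a‖ₑ ∂μ) * (D * (μ A')⁻¹) := by
            gcongr
            rw [← div_eq_mul_inv, ENNReal.le_div_iff_mul_le (Or.inl hA0') (Or.inl hAt'), mul_comm]
            exact ENNReal.div_le_of_le_mul hD
        _ = _ := by ring

theorem enorm_setAverage_le {A : Set X} (hA0 : μ A ≠ 0) (hAt : μ A ≠ ∞) {v : X → ℝ}
    (hv : AEMeasurable v μ) (hvA : IntegrableOn v A μ) {p : ℝ} (hp : 1 < p) :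
    ‖⨍ x in A, v x ∂μ‖ₑ ≤ (∫⁻ x, ‖v x‖ₑ ^ p ∂μ) ^ (1 / p) * (μ A ^ (1 / p))⁻¹ := by
  have h1 := enorm_setAverage_sub_le hA0 hAt hvA 0
  simp only [sub_zero] at h1
  refine h1.trans ?_
  rw [setLAverage_eq]
  refine ENNReal.div_le_of_le_mul ?_
  have h2 := setLIntegral_rpow_le hv.enorm zero_lt_one hp A
  simp only [ENNReal.rpow_one] at h2
  refine h2.trans ?_
  rw [mul_assoc, ENNReal.rpow_sub _ _ hA0 hAt, ENNReal.rpow_one, ENNReal.div_eq_inv_mul]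
  gcongr
  exact Measure.restrict_le_self

end Balls

/-- On the annulus from `r k` to `r (k + 1)`, of width at least `r k`, the integrand is at least its
value with `ρ = r k` and the outer ball. Doubling then replaces the outer ball by the inner one. -/
theorem tsum_le_volumeGrowthIntegral {X : Type*} [MetricSpace X] [MeasurableSpace X]
    {p : ℝ} (hp : 1 < p) {μ : Measure X} {x₀ : X} {r₀ : ℝ} {r : ℕ → ℝ} (hr : Monotone r)
    (hr₀ : r₀ ≤ r 0) (hr2 : ∀ k, 2 * r k ≤ r (k + 1)) {D : ℝ≥0∞}
    (hm0 : ∀ k, μ (Metric.ball x₀ (r k)) ≠ 0) (hmt : ∀ k, μ (Metric.ball x₀ (r k)) ≠ ∞)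
    (hD : ∀ k, μ (Metric.ball x₀ (r (k + 1))) ≤ D * μ (Metric.ball x₀ (r k))) :
    ∑' k, ENNReal.ofReal (r k) *
        (ENNReal.ofReal (r k) / μ (Metric.ball x₀ (r k))) ^ (1 / (p - 1)) ≤
      D ^ (1 / (p - 1)) * volumeGrowthIntegral p μ x₀ r₀ := by
  set e := 1 / (p - 1) with he
  have he0 : 0 ≤ e := one_div_nonneg.2 (by linarith)
  have hpiece : ∀ k, ENNReal.ofReal (r k) *
      (ENNReal.ofReal (r k) / μ (Metric.ball x₀ (r k))) ^ e ≤
      D ^ e * ∫⁻ ρ in Ioc (r k) (r (k + 1)), (ENNReal.ofReal ρ / μ (Metric.ball x₀ ρ)) ^ e := by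
    intro k
    have h1 : (ENNReal.ofReal (r k) / μ (Metric.ball x₀ (r (k + 1)))) ^ e * ENNReal.ofReal (r k) ≤
        ∫⁻ ρ in Ioc (r k) (r (k + 1)), (ENNReal.ofReal ρ / μ (Metric.ball x₀ ρ)) ^ e := by
      calc _ ≤ (ENNReal.ofReal (r k) / μ (Metric.ball x₀ (r (k + 1)))) ^ e *
            volume (Ioc (r k) (r (k + 1))) := by
            rw [Real.volume_Ioc]
            gcongr
            linarith [hr2 k]
        _ = ∫⁻ _ in Ioc (r k) (r (k + 1)),
            (ENNReal.ofReal (r k) / μ (Metric.ball x₀ (r (k + 1)))) ^ e :=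
            (setLIntegral_const _ _).symm
        _ ≤ _ := by
            refine setLIntegral_mono' measurableSet_Ioc fun ρ hρ => ?_
            gcongr
            · exact hρ.1.le
            · exact hρ.2
    have h2 : ENNReal.ofReal (r k) / μ (Metric.ball x₀ (r k)) ≤
        D * (ENNReal.ofReal (r k) / μ (Metric.ball x₀ (r (k + 1)))) := by
      rw [← mul_div_assoc, ENNReal.le_div_iff_mul_le (Or.inl (hm0 _)) (Or.inl (hmt _))]
      calc _ ≤ ENNReal.ofReal (r k) / μ (Metric.ball x₀ (r k)) *
            (D * μ (Metric.ball x₀ (r k))) := by gcongr; exact hD k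
        _ = D * (ENNReal.ofReal (r k) / μ (Metric.ball x₀ (r k)) * μ (Metric.ball x₀ (r k))) := by
            ring
        _ = _ := by rw [ENNReal.div_mul_cancel (hm0 _) (hmt _)]
    calc _ ≤ ENNReal.ofReal (r k) *
          (D * (ENNReal.ofReal (r k) / μ (Metric.ball x₀ (r (k + 1))))) ^ e := by gcongr
      _ = D ^ e * ((ENNReal.ofReal (r k) / μ (Metric.ball x₀ (r (k + 1)))) ^ e *
          ENNReal.ofReal (r k)) := by
          rw [ENNReal.mul_rpow_of_nonneg _ _ he0]; ring
      _ ≤ _ := by gcongr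
  refine (ENNReal.tsum_le_tsum hpiece).trans ?_
  rw [ENNReal.tsum_mul_left]
  gcongr
  have hdisj := hr.pairwise_disjoint_on_Ioc_succ
  simp only [Order.succ_eq_add_one] at hdisj
  rw [← lintegral_iUnion (fun _ => measurableSet_Ioc) hdisj]
  exact lintegral_mono_set (iUnion_subset fun k ρ hρ =>
    (hr₀.trans (hr (Nat.zero_le k))).trans_lt hρ.1)

/-- Hölder's inequality for the weights `R_k m_k^{-1/p}`, where the conjugate exponent turns the
weights into `R_k (R_k / m_k)^{1/(p-1)}`. -/
theorem tsum_weight_mul_le {p : ℝ} (hp : 1 < p) {R m Z : ℕ → ℝ≥0∞} (hR : ∀ k, R k ≠ 0)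
    (hRt : ∀ k, R k ≠ ∞) :
    ∑' k, R k * (m k ^ (1 / p))⁻¹ * Z k ≤
      (∑' k, R k * (R k / m k) ^ (1 / (p - 1))) ^ ((p - 1) / p) *
        (∑' k, Z k ^ p) ^ (1 / p) := by
  have hp0 : 0 < p := by linarith
  have hp1 : 0 < p - 1 := by linarith
  have hconj : (p / (p - 1)).HolderConjugate p := by
    rw [Real.holderConjugate_iff]
    refine ⟨(one_lt_div hp1).2 (by linarith), ?_⟩
    field_simp
    ring
  have hweight : ∀ k, (R k * (m k ^ (1 / p))⁻¹) ^ (p / (p - 1)) =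
      R k * (R k / m k) ^ (1 / (p - 1)) := by
    intro k
    have hexp : p / (p - 1) = 1 + 1 / (p - 1) := by field_simp; ring
    have hexp' : 1 / p * (p / (p - 1)) = 1 / (p - 1) := by field_simp
    have he : 0 ≤ 1 / (p - 1) := (one_div_pos.2 hp1).le
    rw [ENNReal.mul_rpow_of_nonneg _ _ (div_pos hp0 hp1).le, ENNReal.inv_rpow,
      ← ENNReal.rpow_mul, hexp', hexp, ENNReal.rpow_add _ _ (hR k) (hRt k), ENNReal.rpow_one,
      ENNReal.div_rpow_of_nonneg _ _ he, mul_assoc, ← div_eq_mul_inv]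
  rw [ENNReal.tsum_eq_iSup_nat]
  refine iSup_le fun N => ?_
  refine (ENNReal.inner_le_Lp_mul_Lq _ _ _ hconj).trans ?_
  simp only [hweight, one_div_div]
  gcongr
  · exact ENNReal.sum_le_tsum _
  · exact ENNReal.sum_le_tsum _

theorem tendsto_measure_nhds_top {m : ℕ → ℝ≥0∞} (hm0 : m 0 ≠ 0) {c : ℝ≥0∞} (hc1 : 1 < c)
    (hc : ∀ k, c * m k ≤ m (k + 1)) : Filter.Tendsto m Filter.atTop (nhds ∞) := by
  have hpow : ∀ k, m 0 * c ^ k ≤ m k := by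
    intro k
    induction k with
    | zero => simp
    | succ k ih =>
      calc m 0 * c ^ (k + 1) = c * (m 0 * c ^ k) := by ring
        _ ≤ c * m k := by gcongr
        _ ≤ _ := hc k
  have h := ENNReal.Tendsto.const_mul (a := m 0)
    (ENNReal.tendsto_pow_atTop_nhds_top_iff.2 hc1) (Or.inl ENNReal.top_ne_zero)
  rw [ENNReal.mul_top hm0] at h
  exact tendsto_of_tendsto_of_tendsto_of_le_of_le h tendsto_const_nhds hpow fun _ => le_top

/-- The averages of `v` telescope from `1` on `B 0`, each step costing `D` times an oscillation. By
Hölder the average over `B N` is at most `‖v‖_p * μ (B N) ^ (-1/p)`, which tends to `0`. -/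
theorem one_le_tsum_oscillation {X : Type*} [MeasurableSpace X] {μ : Measure X} {B : ℕ → Set X}
    (hB : Monotone B) (hBm : MeasurableSet (B 0)) (hB0 : ∀ k, μ (B k) ≠ 0)
    (hBt : ∀ k, μ (B k) ≠ ∞)
    {c D : ℝ≥0∞} (hc1 : 1 < c) (hc : ∀ k, c * μ (B k) ≤ μ (B (k + 1)))
    (hD : ∀ k, μ (B (k + 1)) ≤ D * μ (B k)) {p : ℝ} (hp : 1 < p) {v : X → ℝ}
    (hv : AEMeasurable v μ) {M : ℝ} (hM : ∀ x, |v x| ≤ M) (hv1 : ∀ x ∈ B 0, v x = 1)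
    (hvp : ∫⁻ x, ‖v x‖ₑ ^ p ∂μ ≠ ∞) :
    1 ≤ D * ∑' k, ⨍⁻ x in B (k + 1), ‖v x - ⨍ y in B (k + 1), v y ∂μ‖ₑ ∂μ := by
  set osc : ℕ → ℝ≥0∞ := fun k => ⨍⁻ x in B k, ‖v x - ⨍ y in B k, v y ∂μ‖ₑ ∂μ with hosc
  have hp0 : 0 < 1 / p := one_div_pos.2 (by linarith)
  have hint : ∀ k, IntegrableOn v (B k) μ := fun k =>
    Measure.integrableOn_of_bounded (hBt k) hv.aestronglyMeasurable (ae_of_all _ fun x => hM x)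
  have h0 : ‖⨍ x in B 0, v x ∂μ‖ₑ = 1 := by
    have : ⨍ x in B 0, v x ∂μ = 1 := by
      rw [setAverage_eq, setIntegral_congr_fun hBm hv1, ← setAverage_eq]
      exact setAverage_const (hB0 0) (hBt 0) 1
    rw [this, enorm_one]
  have hsum : ∀ N, 1 ≤ ‖⨍ x in B N, v x ∂μ‖ₑ + D * ∑ k ∈ Finset.range N, osc (k + 1) := by
    intro N
    induction N with
    | zero => simp [h0]
    | succ N ih =>
      refine ih.trans ?_
      rw [Finset.sum_range_succ, mul_add]
      calc _ ≤ ‖⨍ x in B (N + 1), v x ∂μ‖ₑ + D * osc (N + 1) +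
            D * ∑ k ∈ Finset.range N, osc (k + 1) := by
            gcongr
            exact enorm_setAverage_le_add (hB (Nat.le_succ N)) (hB0 N) (hBt N) (hBt _) (hD N)
              (hint N)
        _ = _ := by ring
  have hlim : Filter.Tendsto (fun N => (∫⁻ x, ‖v x‖ₑ ^ p ∂μ) ^ (1 / p) * (μ (B N) ^ (1 / p))⁻¹ +
      D * ∑' k, osc (k + 1)) Filter.atTop (nhds (D * ∑' k, osc (k + 1))) := by
    have h1 : Filter.Tendsto (fun N => (μ (B N) ^ (1 / p))⁻¹) Filter.atTop (nhds 0) := by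
      have h2 := (ENNReal.continuous_rpow_const (y := 1 / p)).tendsto ∞
      rw [ENNReal.top_rpow_of_pos hp0] at h2
      have h3 := (h2.comp (tendsto_measure_nhds_top (m := fun k => μ (B k)) (hB0 0) hc1 hc)).inv
      simpa using h3
    have h4 := ENNReal.Tendsto.const_mul (a := (∫⁻ x, ‖v x‖ₑ ^ p ∂μ) ^ (1 / p)) h1
      (Or.inr (ENNReal.rpow_ne_top_of_nonneg hp0.le hvp))
    rw [mul_zero] at h4
    simpa using h4.add_const (D * ∑' k, osc (k + 1))
  refine ge_of_tendsto' hlim fun N => (hsum N).trans ?_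
  gcongr
  · exact enorm_setAverage_le (hB0 N) (hBt N) hv (hint N) hp
  · exact ENNReal.sum_le_tsum _

/-! ### Lower bound for the capacity and necessity of divergence -/

/-- Lower bound for the energy of competitors for the capacity of a ball, along a sequence of
balls with Poincaré inequalities. -/
theorem exists_one_le_mul_lintegral_rpow {X : Type*} [MetricSpace X] [MeasurableSpace X]
    [BorelSpace X] {μ : Measure X} (hμ : ∀ (x : X) (r : ℝ), μ (Metric.ball x r) < ∞)
    {x₀ : X} {p₀ p : ℝ} (hp₀ : 0 < p₀) (hp₀p : p₀ < p) (hp : 1 < p)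
    {r : ℕ → ℝ} (hr : Monotone r) (hrpos : ∀ k, 0 < r k) {c D : ℝ≥0∞} (hc1 : 1 < c) (hDt : D ≠ ∞)
    (hm0 : ∀ k, μ (Metric.ball x₀ (r k)) ≠ 0)
    (hc : ∀ k, c * μ (Metric.ball x₀ (r k)) ≤ μ (Metric.ball x₀ (r (k + 1))))
    (hD : ∀ k, μ (Metric.ball x₀ (r (k + 1))) ≤ D * μ (Metric.ball x₀ (r k)))
    {C : ℝ} {M : ℝ} (hosc : ∀ k, ∀ v : X → ℝ, AEMeasurable v μ → (∀ x, |v x| ≤ M) →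
      ∀ g : X → ℝ≥0∞, IsWeakUpperGradient p₀ μ (fun x => (v x : EReal)) g →
        ⨍⁻ x in Metric.ball x₀ (r k), ‖v x - ⨍ y in Metric.ball x₀ (r k), v y ∂μ‖ₑ ∂μ ≤
          ENNReal.ofReal (C * r k) * ((∫⁻ x in Metric.ball x₀ (r (k + 1)), g x ^ p₀ ∂μ) /
            μ (Metric.ball x₀ (r k))) ^ (1 / p₀)) (hC : 0 ≤ C)
    (hsum : ∑' k, ENNReal.ofReal (r k) *
      (ENNReal.ofReal (r k) / μ (Metric.ball x₀ (r k))) ^ (1 / (p - 1)) ≠ ∞) :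
    ∃ K : ℝ≥0∞, K ≠ ∞ ∧ ∀ (v : X → ℝ) (g : X → ℝ≥0∞), AEMeasurable v μ → (∀ x, |v x| ≤ M) →
      (∀ x ∈ Metric.ball x₀ (r 0), v x = 1) → ∫⁻ x, ‖v x‖ₑ ^ p ∂μ ≠ ∞ →
      IsWeakUpperGradient p μ (fun x => (v x : EReal)) g →
        1 ≤ K * (∫⁻ x, g x ^ p ∂μ) ^ (1 / p) := by
  have hp' : 0 < p := by linarith
  have hp1 : 0 < p - 1 := by linarith
  set B : ℕ → Set X := fun k => Metric.ball x₀ (r k) with hBdef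
  have hB : Monotone B := fun i j hij => Metric.ball_subset_ball (hr hij)
  have hBt : ∀ k, μ (B k) ≠ ∞ := fun k => (hμ _ _).ne
  obtain ⟨Q, hQt, hQ⟩ := tsum_rpow_setLIntegral_div_le hB (fun k => measurableSet_ball) hm0 hBt
    hc1 hc hp₀ hp₀p
  set S := ∑' k, ENNReal.ofReal (r k) * (ENNReal.ofReal (r k) / μ (B k)) ^ (1 / (p - 1)) with hS
  refine ⟨D * (ENNReal.ofReal C * D ^ (1 / p₀) * (S ^ ((p - 1) / p) * Q ^ (1 / p))), ?_, ?_⟩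
  · have h1 : 0 ≤ 1 / p₀ := (one_div_pos.2 hp₀).le
    have h2 : 0 ≤ 1 / p := (one_div_pos.2 hp').le
    have h3 : 0 ≤ (p - 1) / p := (div_pos hp1 hp').le
    exact ENNReal.mul_ne_top hDt (ENNReal.mul_ne_top (ENNReal.mul_ne_top ENNReal.ofReal_ne_top
      (ENNReal.rpow_ne_top_of_nonneg h1 hDt)) (ENNReal.mul_ne_top
        (ENNReal.rpow_ne_top_of_nonneg h3 hsum) (ENNReal.rpow_ne_top_of_nonneg h2 hQt)))
  intro v g hv hM hv1 hvp hg
  have hosc' := fun k => hosc k v hv hM g (hg.mono_exponent hμ hp₀ hp₀p)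
  set T : ℕ → ℝ≥0∞ := fun k => ∫⁻ x in B k, g x ^ p₀ ∂μ with hT
  set Y : ℕ → ℝ≥0∞ := fun k => T k / μ (B k) ^ (1 - p₀ / p) with hY
  have hbound : ∀ k, ⨍⁻ x in B k, ‖v x - ⨍ y in B k, v y ∂μ‖ₑ ∂μ ≤
      ENNReal.ofReal C * D ^ (1 / p₀) * (ENNReal.ofReal (r (k + 1)) *
        (μ (B (k + 1)) ^ (1 / p))⁻¹ * Y (k + 1) ^ (1 / p₀)) := by
    intro k
    -- Doubling moves the measure to `B (k + 1)`, and its exponent splits as `(1 - p₀ / p) + p₀ /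
    -- p`. The first part normalizes `Y`; the `1 / p₀` power of the second is the weight `μ (B (k +
    -- 1)) ^ (-1/p)`.
    have h1 : T (k + 1) / μ (B k) ≤ D * (Y (k + 1) * (μ (B (k + 1)) ^ (p₀ / p))⁻¹) := by
      have h2 : Y (k + 1) * (μ (B (k + 1)) ^ (p₀ / p))⁻¹ = T (k + 1) / μ (B (k + 1)) := by
        simp only [hY, div_eq_mul_inv (T (k + 1))]
        rw [mul_assoc, ← ENNReal.rpow_neg, ← ENNReal.rpow_neg,
          ← ENNReal.rpow_add _ _ (hm0 _) (hBt _), ← ENNReal.rpow_neg_one]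
        congr 2
        ring
      rw [h2]
      refine ENNReal.div_le_of_le_mul ?_
      calc T (k + 1) = T (k + 1) / μ (B (k + 1)) * μ (B (k + 1)) :=
            (ENNReal.div_mul_cancel (hm0 _) (hBt _)).symm
        _ ≤ T (k + 1) / μ (B (k + 1)) * (D * μ (B k)) := by gcongr; exact hD k
        _ = _ := by ring
    have hp₀' : 0 ≤ 1 / p₀ := (one_div_pos.2 hp₀).le
    calc _ ≤ ENNReal.ofReal (C * r k) * (T (k + 1) / μ (B k)) ^ (1 / p₀) := hosc' k
      _ ≤ ENNReal.ofReal (C * r (k + 1)) *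
          (D * (Y (k + 1) * (μ (B (k + 1)) ^ (p₀ / p))⁻¹)) ^ (1 / p₀) := by
          gcongr
          exact hr (Nat.le_succ k)
      _ = _ := by
          rw [ENNReal.ofReal_mul hC, ENNReal.mul_rpow_of_nonneg _ _ hp₀',
            ENNReal.mul_rpow_of_nonneg _ _ hp₀', ENNReal.inv_rpow, ← ENNReal.rpow_mul,
            show p₀ / p * (1 / p₀) = 1 / p by field_simp]
          ring
  have htsum : ∑' k, ⨍⁻ x in B (k + 1), ‖v x - ⨍ y in B (k + 1), v y ∂μ‖ₑ ∂μ ≤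
      ENNReal.ofReal C * D ^ (1 / p₀) * ∑' k, ENNReal.ofReal (r k) *
        (μ (B k) ^ (1 / p))⁻¹ * Y k ^ (1 / p₀) := by
    refine (ENNReal.tsum_le_tsum fun k => hbound (k + 1)).trans ?_
    rw [ENNReal.tsum_mul_left]
    refine mul_le_mul_right ?_ _
    -- The shift is `2`: the oscillations start at `B 1`, and each is estimated on the next ball.
    exact ENNReal.tsum_comp_le_tsum_of_injective (add_left_injective 2)
      (fun k => ENNReal.ofReal (r k) * (μ (B k) ^ (1 / p))⁻¹ * Y k ^ (1 / p₀))
  have hholder := tsum_weight_mul_le hp (R := fun k => ENNReal.ofReal (r k))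
    (m := fun k => μ (B k)) (Z := fun k => Y k ^ (1 / p₀))
    (fun k => (ENNReal.ofReal_pos.2 (hrpos k)).ne') (fun k => ENNReal.ofReal_ne_top)
  have hZ : ∑' k, (Y k ^ (1 / p₀)) ^ p ≤ Q * ∫⁻ x, g x ^ p ∂μ := by
    simp only [← ENNReal.rpow_mul, one_div_mul_eq_div]
    exact hQ g hg.1
  calc (1 : ℝ≥0∞) ≤ D * ∑' k, ⨍⁻ x in B (k + 1), ‖v x - ⨍ y in B (k + 1), v y ∂μ‖ₑ ∂μ :=
        one_le_tsum_oscillation hB measurableSet_ball hm0 hBt hc1 hc hD hp hv hM hv1 hvp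
    _ ≤ D * (ENNReal.ofReal C * D ^ (1 / p₀) *
        (S ^ ((p - 1) / p) * (Q * ∫⁻ x, g x ^ p ∂μ) ^ (1 / p))) := by
        gcongr
        refine htsum.trans ?_
        gcongr
        refine hholder.trans ?_
        gcongr
    _ = _ := by
        rw [ENNReal.mul_rpow_of_nonneg _ _ (one_div_pos.2 hp').le]
        ring

theorem DoublingAtLarge.pow {X : Type*} [MetricSpace X] [MeasurableSpace X] {μ : Measure X}
    {x₀ : X} {R₀ C : ℝ} (hR₀ : 0 < R₀) (h : ∀ r : ℝ, R₀ ≤ r →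
      μ (Metric.ball x₀ (2 * r)) ≤ ENNReal.ofReal C * μ (Metric.ball x₀ r)) (n : ℕ) {r : ℝ}
    (hr : R₀ ≤ r) :
    μ (Metric.ball x₀ (2 ^ n * r)) ≤ ENNReal.ofReal C ^ n * μ (Metric.ball x₀ r) := by
  induction n with
  | zero => simp
  | succ n ih =>
    have hle : R₀ ≤ 2 ^ n * r :=
      hr.trans (le_mul_of_one_le_left (hR₀.le.trans hr) (one_le_pow₀ one_le_two))
    calc μ (Metric.ball x₀ (2 ^ (n + 1) * r)) = μ (Metric.ball x₀ (2 * (2 ^ n * r))) := by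
          congr 2; ring
      _ ≤ ENNReal.ofReal C * μ (Metric.ball x₀ (2 ^ n * r)) := h _ hle
      _ ≤ ENNReal.ofReal C * (ENNReal.ofReal C ^ n * μ (Metric.ball x₀ r)) := by gcongr
      _ = _ := by ring

theorem volumeGrowthIntegral_eq_top_of_isParabolic {X : Type*} [MetricSpace X] [MeasurableSpace X]
    [BorelSpace X] {μ : Measure X}
    (hμ : ∀ (x : X) (r : ℝ), 0 < r → 0 < μ (Metric.ball x r) ∧ μ (Metric.ball x r) < ∞)
    (hX : ¬ Bornology.IsBounded (univ : Set X)) {p p₀ : ℝ} (hp : 1 < p) (hp₀ : 1 ≤ p₀)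
    (hp₀p : p₀ < p) {x₀ : X} (hdoub : DoublingAtLarge μ x₀) (hrev : ReverseDoublingAtLarge μ x₀)
    (hpoin : PoincareAtLarge p₀ μ x₀) (hpar : IsParabolic p μ) (r₀ : ℝ) :
    volumeGrowthIntegral p μ x₀ r₀ = ∞ := by
  by_contra hfin
  obtain ⟨R₁, hR₁, C₁, -, hdoub⟩ := hdoub
  obtain ⟨R₂, -, ξ, hξ, C₂, hC₂, hrev⟩ := hrev
  obtain ⟨R₃, -, C, hC, lam, hlam, hpoin⟩ := hpoin
  -- Unboundedness makes the diameter restriction in the reverse-doubling condition void.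
  have hdiam : Metric.ediam (univ : Set X) = ∞ := Metric.ediam_eq_top_iff_unbounded.2 hX
  have hball : ∀ (x : X) (r : ℝ), μ (Metric.ball x r) < ∞ := fun x r => by
    rcases le_or_gt r 0 with h | h
    · simp [Metric.ball_eq_empty.2 h]
    · exact (hμ x r h).2
  -- The ratio `σ` is a power of `2` so that doubling iterates. It dominates `ξ` for measure growth
  -- at each step, `lam` so that the dilated ball fits in the next one, and `2` for the comparison
  -- with the integral.
  obtain ⟨n, hn⟩ := pow_unbounded_of_one_lt (max 2 (max ξ lam)) (one_lt_two (α := ℝ))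
  set σ : ℝ := 2 ^ n with hσ
  have hσ2 : 2 ≤ σ := (le_max_left _ _).trans hn.le
  have hσξ : ξ ≤ σ := ((le_max_left _ _).trans (le_max_right _ _)).trans hn.le
  have hσlam : lam ≤ σ := ((le_max_right _ _).trans (le_max_right _ _)).trans hn.le
  set R := max (max R₁ R₂) (max R₃ r₀) with hR
  have hRR₁ : R₁ ≤ R := (le_max_left _ _).trans (le_max_left _ _)
  have hR0 : 0 < R := hR₁.trans_le hRR₁
  set r : ℕ → ℝ := fun k => σ ^ k * R with hr
  have hsucc : ∀ k, r (k + 1) = σ * r k := fun k => by simp only [hr]; ring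
  have hRr : ∀ k, R ≤ r k := fun k =>
    le_mul_of_one_le_left hR0.le (one_le_pow₀ (by linarith))
  have hrpos : ∀ k, 0 < r k := fun k => hR0.trans_le (hRr k)
  have hmono : Monotone r := monotone_nat_of_le_succ fun k => by
    rw [hsucc]; nlinarith [hrpos k]
  have hm0 : ∀ k, μ (Metric.ball x₀ (r k)) ≠ 0 := fun k => (hμ x₀ _ (hrpos k)).1.ne'
  have hD : ∀ k, μ (Metric.ball x₀ (r (k + 1))) ≤
      ENNReal.ofReal C₁ ^ n * μ (Metric.ball x₀ (r k)) := fun k => by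
    rw [hsucc]
    exact DoublingAtLarge.pow hR₁ hdoub n (hRR₁.trans (hRr k))
  have hc : ∀ k, ENNReal.ofReal C₂ * μ (Metric.ball x₀ (r k)) ≤
      μ (Metric.ball x₀ (r (k + 1))) := fun k => by
    refine (hrev (r k) (((le_max_right _ _).trans (le_max_left _ _)).trans (hRr k))
      (hdiam ▸ le_top)).trans ?_
    rw [hsucc]
    exact measure_mono (Metric.ball_subset_ball (mul_le_mul_of_nonneg_right hσξ (hrpos k).le))
  have hosc : ∀ k, ∀ v : X → ℝ, AEMeasurable v μ → (∀ x, |v x| ≤ 1) →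
      ∀ g : X → ℝ≥0∞, IsWeakUpperGradient p₀ μ (fun x => (v x : EReal)) g →
        ⨍⁻ x in Metric.ball x₀ (r k), ‖v x - ⨍ y in Metric.ball x₀ (r k), v y ∂μ‖ₑ ∂μ ≤
          ENNReal.ofReal (C * r k) * ((∫⁻ x in Metric.ball x₀ (r (k + 1)), g x ^ p₀ ∂μ) /
            μ (Metric.ball x₀ (r k))) ^ (1 / p₀) := by
    intro k v hv hM g hg
    refine (poincare_of_bounded (hball x₀) (hrpos k).le hlam
      (hpoin (r k) (((le_max_left _ _).trans (le_max_right _ _)).trans (hRr k)))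
      hv hM hg).trans ?_
    rw [setLAverage_eq]
    -- In the mean over the dilated ball, the domain of integration grows to the next ball and the
    -- measure in the denominator shrinks to that of `B(x₀, r k)`.
    have h1 : r k ≤ lam * r k := le_mul_of_one_le_left (hrpos k).le hlam
    have h2 : lam * r k ≤ r (k + 1) := by
      rw [hsucc]; exact mul_le_mul_of_nonneg_right hσlam (hrpos k).le
    gcongr
  have htsum := tsum_le_volumeGrowthIntegral hp hmono
    (((le_max_right _ _).trans (le_max_right _ _)).trans (hRr 0) : r₀ ≤ r 0)
    (fun k => by rw [hsucc]; exact mul_le_mul_of_nonneg_right hσ2 (hrpos k).le)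
    hm0 (fun k => (hball x₀ _).ne) hD
  have hDt : ENNReal.ofReal C₁ ^ n ≠ ∞ := ENNReal.pow_ne_top ENNReal.ofReal_ne_top
  obtain ⟨K, hKt, hK⟩ := exists_one_le_mul_lintegral_rpow hball (by linarith) hp₀p hp hmono hrpos
    (ENNReal.one_lt_ofReal.2 hC₂) hDt hm0 hc hD hosc hC.le
    (ne_top_of_le_ne_top (ENNReal.mul_ne_top (ENNReal.rpow_ne_top_of_nonneg
      (one_div_nonneg.2 (by linarith)) hDt) hfin) htsum)
  have hp' : 0 < p := by linarith
  have hle : (K⁻¹) ^ p ≤ varCapacity p μ (Metric.ball x₀ (r 0)) univ := by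
    refine le_iInf₂ fun u hu => le_iInf₂ fun _ h1 => le_iInf₂ fun g hg => le_iInf fun _ => ?_
    rw [Measure.restrict_univ]
    -- Truncating `u` keeps `g` as a weak upper gradient, makes the function finite and bounded by
    -- `1`, and gives exactly `1` on the ball.
    have hone := hK (fun x => unitClamp (u x)) g (measurable_unitClamp.comp_aemeasurable hu.1)
      (fun x => by rw [abs_of_nonneg (unitClamp_nonneg _)]; exact unitClamp_le_one _)
      (fun x hx => unitClamp_of_one_le (h1 x hx)) ?_ hg.unitClamp
    · have h2 : K⁻¹ ≤ (∫⁻ x, g x ^ p ∂μ) ^ (1 / p) := by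
        rw [ENNReal.inv_le_iff_le_mul]
        · exact hone
        · rintro - rfl; simp at hone
        · exact fun h => absurd h hKt
      calc K⁻¹ ^ p ≤ ((∫⁻ x, g x ^ p ∂μ) ^ (1 / p)) ^ p := ENNReal.rpow_le_rpow h2 hp'.le
        _ = _ := by rw [← ENNReal.rpow_mul, one_div_mul_cancel hp'.ne', ENNReal.rpow_one]
    · refine ne_top_of_le_ne_top (ENNReal.add_lt_top.1 hu.2).1.ne (lintegral_mono fun x => ?_)
      rw [Real.enorm_of_nonneg (unitClamp_nonneg _)]
      exact ENNReal.rpow_le_rpow (ofReal_unitClamp_le _) hp'.le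
  rw [hpar x₀ (r 0) (hrpos 0), nonpos_iff_eq_zero, ENNReal.rpow_eq_zero_iff_of_pos hp',
    ENNReal.inv_eq_zero] at hle
  exact hKt hle

end MetricSobolev

theorem theorem5p5 {X : Type*} [MetricSpace X] [MeasurableSpace X] [BorelSpace X]
    (μ : Measure X)
    (hμ : ∀ (x : X) (r : ℝ), 0 < r → 0 < μ (Metric.ball x r) ∧ μ (Metric.ball x r) < ∞)
    (hX : ¬ Bornology.IsBounded (univ : Set X))
    (p : ℝ) (hp : 1 < p) (x₀ : X) (r₀ : ℝ) (hr₀ : 0 < r₀) :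
    (MetricSobolev.volumeGrowthIntegral p μ x₀ r₀ = ∞ → MetricSobolev.IsParabolic p μ) ∧
    (MetricSobolev.DoublingAtLarge μ x₀ →
      MetricSobolev.ReverseDoublingAtLarge μ x₀ →
      (∃ p₀ : ℝ, 1 ≤ p₀ ∧ p₀ < p ∧ MetricSobolev.PoincareAtLarge p₀ μ x₀) →
      (MetricSobolev.IsParabolic p μ ↔ MetricSobolev.volumeGrowthIntegral p μ x₀ r₀ = ∞)) := by
  have hsuff : MetricSobolev.volumeGrowthIntegral p μ x₀ r₀ = ∞ → MetricSobolev.IsParabolic p μ :=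
    MetricSobolev.isParabolic_of_volumeGrowthIntegral_eq_top hp (hμ x₀) hr₀
  refine ⟨hsuff, fun hdoub hrev ⟨p₀, hp₀, hp₀p, hpoin⟩ => ⟨fun hpar => ?_, hsuff⟩⟩
  exact MetricSobolev.volumeGrowthIntegral_eq_top_of_isParabolic hμ hX hp hp₀ hp₀p hdoub hrev
    hpoin hpar r₀
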